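/- There is a polynomial-time algorithm which, for every instance with additive valuations, turns an allocation with a large Nash welfare into a fair one with a large Nash welfare. Precisely, there are a single program $P$ and a single polynomial $p$ such that the following holds for all numbers $n$ of agents and $m$ of items, all additive valuations $v_1,\dots,v_n : 2^{[m]}\to\mathbb{R}_{\ge 0}$ (that is, $v_i(S\cup T)=v_i(S)+v_i(T)$ for disjoint $S,T$), all $\alpha\in[0,1]$, all $\beta\in(0,1)$, and every (possibly partial) allocation $X$ that is $\beta$-MNW: given as input $n$, $m$, $\alpha$, the values $v_i(\{g\})$ ($i\in[n]$, $g\in[m]$) and $X$, but not $\beta$, the program $P$ halts after at most $p(n+m)/\beta$ steps and outputs a (possibly partial) allocation that is $\alpha$-EFX and $\frac{\beta}{\alpha+1}$-MNW. Here an allocation is a tuple $X=(X_1,\dots,X_n)$ of pairwise disjoint subsets of $[m]$, not necessarily covering $[m]$; its Nash welfare is $\mathrm{NW}(X)=\prod_{i} v_i(X_i)^{1/n}$; an MNW allocation is one that maximizes $\mathrm{NW}$ among all allocations; $Z$ is $\beta$-MNW if $\mathrm{NW}(Z)\ge\beta\,\mathrm{NW}(X)$ for an MNW allocation $X$; and $Z$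 is $\alpha$-EFX if $v_i(Z_i)\ge\alpha\, v_i(Z_j\setminus\{g\})$ for all agents $i,j$ and all $g\in Z_j$. Programs run on a deterministic random access machine with registers and indirectly addressed arrays for natural numbers (constants, addition, truncated subtraction, comparison) and for real numbers (natural number constants, addition, subtraction, comparison, and multiplication by an input number, but neither rounding nor the product of two computed numbers); every elementary operation and every test is one step. -/

import Mathlib

namespace FairDiv

/-! ### Valuations and allocations -/

/-- Additivity of a set function on a finite set of items. -/
def IsAdditive {m : ℕ} (w : Finset (Fin m) → ℝ) : Prop :=
  ∀ S T : Finset (Fin m), Disjoint S T → w (S ∪ T) = w S + w T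

/-- A (possibly partial) allocation: the bundles of distinct agents are disjoint. -/
def IsAllocation {n m : ℕ} (X : Fin n → Finset (Fin m)) : Prop :=
  ∀ i j : Fin n, i ≠ j → Disjoint (X i) (X j)

/-- The Nash welfare: the geometric mean of the values of the agents for their bundles. -/
noncomputable def nashWelfare {n m : ℕ} (v : Fin n → Finset (Fin m) → ℝ)
    (X : Fin n → Finset (Fin m)) : ℝ :=
  ∏ i, (v i (X i)) ^ (1 / (n : ℝ))

/-- A maximum Nash welfare allocation. -/
def IsMNW {n m : ℕ} (v : Fin n → Finset (Fin m) → ℝ) (X : Fin n → Finset (Fin m)) : Prop :=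
  IsAllocation X ∧ ∀ Y, IsAllocation Y → nashWelfare v Y ≤ nashWelfare v X

/-- `Z` has at least a `β` fraction of the maximum Nash welfare. -/
def IsApproxMNW {n m : ℕ} (v : Fin n → Finset (Fin m) → ℝ) (β : ℝ)
    (Z : Fin n → Finset (Fin m)) : Prop :=
  ∀ X, IsMNW v X → β * nashWelfare v X ≤ nashWelfare v Z

/-- `α`-EFX: no agent values another bundle minus any one of its items at more than `1/α` times
her own bundle. -/
def IsEFX {n m : ℕ} (v : Fin n → Finset (Fin m) → ℝ) (α : ℝ)
    (X : Fin n → Finset (Fin m)) : Prop :=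
  ∀ i j : Fin n, ∀ g ∈ X j, α * v i (X j \ {g}) ≤ v i (X i)

/-- A maximum Nash welfare allocation always exists, so `IsApproxMNW` is never vacuous. -/
theorem exists_isMNW {n m : ℕ} (v : Fin n → Finset (Fin m) → ℝ) : ∃ X, IsMNW v X := by
  classical
  obtain ⟨X, hX, hmax⟩ := Finset.exists_max_image
    (Finset.univ.filter fun X : Fin n → Finset (Fin m) => IsAllocation X) (nashWelfare v)
    ⟨fun _ => ∅, Finset.mem_filter.2 ⟨Finset.mem_univ _, fun _ _ _ => Finset.disjoint_empty_left _⟩⟩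
  exact ⟨X, (Finset.mem_filter.1 hX).2, fun Y hY => hmax Y (Finset.mem_filter.2 ⟨Finset.mem_univ _, hY⟩)⟩

/-! ### The machine model

A random access machine with a read-only table `inp` of real input numbers. It has registers and
(unbounded, indirectly addressed) arrays for natural numbers, and registers and arrays for real
numbers. Every elementary operation and every evaluation of a test costs one step.

The only real operations are the constants, addition, subtraction, comparison, and multiplication
by an entry of the input table; natural numbers are only added, subtracted and compared. There is
neither rounding nor a product of two computed numbers, so on rational inputs of total bit length
`L` every number that is computed within `t` steps has bit length polynomial in `t + L`, and
counting every operation as one step is polynomially equivalent to counting bit operations. -/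

/-- Memory contents. -/
structure State where
  /-- registers holding natural numbers -/
  nreg : ℕ → ℕ
  /-- registers holding real numbers -/
  rreg : ℕ → ℝ
  /-- arrays of natural numbers: `narr a k` is entry `k` of array `a` -/
  narr : ℕ → ℕ → ℕ
  /-- arrays of real numbers -/
  rarr : ℕ → ℕ → ℝ

/-- Elementary operations. The arguments are names of registers or arrays, except for the numerical
constant in `nconst` and `rconst`. -/
inductive Op where
  /-- natural register `x` gets the constant `c` -/
  | nconst (x c : ℕ)
  /-- `x` gets `y + z` -/
  | nadd (x y z : ℕ)
  /-- `x` gets `y - z`, truncated at `0` -/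
  | nsub (x y z : ℕ)
  /-- `x` gets the entry of the natural array `a` whose index is in register `y` -/
  | nload (x a y : ℕ)
  /-- the entry of the natural array `a` whose index is in register `x` gets the value of `y` -/
  | nstore (a x y : ℕ)
  /-- real register `r` gets the constant `c` -/
  | rconst (r c : ℕ)
  /-- `r` gets `s + t` -/
  | radd (r s t : ℕ)
  /-- `r` gets `s - t` -/
  | rsub (r s t : ℕ)
  /-- `r` gets `s` times the input in the row and column given by the natural registers `x`, `y` -/
  | rmulInput (r s x y : ℕ)
  /-- `r` gets the entry of the real array `a` whose index is in the natural register `y` -/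
  | rload (r a y : ℕ)
  /-- the entry of the real array `a` whose index is in natural register `x` gets the value of `r` -/
  | rstore (a x r : ℕ)

/-- The effect of an elementary operation. -/
noncomputable def Op.apply (inp : ℕ → ℕ → ℝ) (s : State) : Op → State
  | .nconst x c => { s with nreg := Function.update s.nreg x c }
  | .nadd x y z => { s with nreg := Function.update s.nreg x (s.nreg y + s.nreg z) }
  | .nsub x y z => { s with nreg := Function.update s.nreg x (s.nreg y - s.nreg z) }
  | .nload x a y => { s with nreg := Function.update s.nreg x (s.narr a (s.nreg y)) }
  | .nstore a x y =>
      let new := Function.update (s.narr a) (s.nreg x) (s.nreg y)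
      { s with narr := Function.update s.narr a new }
  | .rconst r c => { s with rreg := Function.update s.rreg r (c : ℝ) }
  | .radd r p q => { s with rreg := Function.update s.rreg r (s.rreg p + s.rreg q) }
  | .rsub r p q => { s with rreg := Function.update s.rreg r (s.rreg p - s.rreg q) }
  | .rmulInput r p x y =>
      { s with rreg := Function.update s.rreg r (s.rreg p * inp (s.nreg x) (s.nreg y)) }
  | .rload r a y => { s with rreg := Function.update s.rreg r (s.rarr a (s.nreg y)) }
  | .rstore a x r =>
      let new := Function.update (s.rarr a) (s.nreg x) (s.rreg r)
      { s with rarr := Function.update s.rarr a new }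

/-- Tests: comparisons of two natural or two real registers. -/
inductive Test where
  | neq (x y : ℕ)
  | nlt (x y : ℕ)
  | rlt (r s : ℕ)

/-- `neq x y` tests whether the registers are equal. -/
def Test.Holds (s : State) : Test → Prop
  | .neq x y => s.nreg x = s.nreg y
  | .nlt x y => s.nreg x < s.nreg y
  | .rlt p q => s.rreg p < s.rreg q

/-- Programs. -/
inductive Prog where
  | op (o : Op)
  | seq (P Q : Prog)
  | ite (b : Test) (P Q : Prog)
  | loop (b : Test) (P : Prog)

/-- `Exec inp P s t s'`: on input `inp`, the program `P` started in state `s` halts in state `s'`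
after exactly `t` steps. -/
inductive Exec (inp : ℕ → ℕ → ℝ) : Prog → State → ℕ → State → Prop
  | op (o : Op) (s : State) : Exec inp (.op o) s 1 (o.apply inp s)
  | seq {P Q : Prog} {s₁ s₂ s₃ : State} {t₁ t₂ : ℕ} (hP : Exec inp P s₁ t₁ s₂)
      (hQ : Exec inp Q s₂ t₂ s₃) : Exec inp (.seq P Q) s₁ (t₁ + t₂) s₃
  | ite_true {b : Test} {P Q : Prog} {s s' : State} {t : ℕ} (hb : b.Holds s)
      (hP : Exec inp P s t s') : Exec inp (.ite b P Q) s (t + 1) s'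
  | ite_false {b : Test} {P Q : Prog} {s s' : State} {t : ℕ} (hb : ¬ b.Holds s)
      (hQ : Exec inp Q s t s') : Exec inp (.ite b P Q) s (t + 1) s'
  | loop_true {b : Test} {P : Prog} {s₁ s₂ s₃ : State} {t₁ t₂ : ℕ} (hb : b.Holds s₁)
      (hP : Exec inp P s₁ t₁ s₂) (hL : Exec inp (.loop b P) s₂ t₂ s₃) :
      Exec inp (.loop b P) s₁ (t₁ + t₂ + 1) s₃
  | loop_false {b : Test} {P : Prog} {s : State} (hb : ¬ b.Holds s) :
      Exec inp (.loop b P) s 1 s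

/-- The machine is deterministic: running time and final state are determined by the input. -/
theorem Exec.deterministic {inp : ℕ → ℕ → ℝ} {P : Prog} {s s₁ s₂ : State} {t₁ t₂ : ℕ}
    (h₁ : Exec inp P s t₁ s₁) (h₂ : Exec inp P s t₂ s₂) : t₁ = t₂ ∧ s₁ = s₂ := by
  induction h₁ generalizing t₂ s₂ with
  | op o s => cases h₂; exact ⟨rfl, rfl⟩
  | seq _ _ ihP ihQ =>
    cases h₂ with
    | seq kP kQ =>
      obtain ⟨rfl, rfl⟩ := ihP kP
      obtain ⟨rfl, rfl⟩ := ihQ kQ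
      exact ⟨rfl, rfl⟩
  | ite_true hb _ ih =>
    cases h₂ with
    | ite_true _ k => obtain ⟨rfl, rfl⟩ := ih k; exact ⟨rfl, rfl⟩
    | ite_false hb' _ => exact absurd hb hb'
  | ite_false hb _ ih =>
    cases h₂ with
    | ite_true hb' _ => exact absurd hb' hb
    | ite_false _ k => obtain ⟨rfl, rfl⟩ := ih k; exact ⟨rfl, rfl⟩
  | loop_true hb _ _ ihP ihL =>
    cases h₂ with
    | loop_true _ kP kL =>
      obtain ⟨rfl, rfl⟩ := ihP kP
      obtain ⟨rfl, rfl⟩ := ihL kL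
      exact ⟨rfl, rfl⟩
    | loop_false hb' => exact absurd hb hb'
  | loop_false hb =>
    cases h₂ with
    | loop_true hb' _ _ => exact absurd hb' hb
    | loop_false _ => exact ⟨rfl, rfl⟩

/-! ### Input and output -/

/-- The input table: entry `(0, 0)` is `α`, entry `(i + 1, g)` is the value of agent `i` for the
single item `g`, and all other entries are `0`. -/
noncomputable def inputTable {n m : ℕ} (v : Fin n → Finset (Fin m) → ℝ) (α : ℝ) : ℕ → ℕ → ℝ
  | 0, g => if g = 0 then α else 0
  | i + 1, g => if h : i < n ∧ g < m then v ⟨i, h.1⟩ {⟨g, h.2⟩} else 0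

/-- An allocation as an array of owners: entry `g` is `i + 1` if agent `i` owns item `g`, and `0` if
nobody owns `g` (in an allocation at most one summand is nonzero). -/
def encodeAlloc {n m : ℕ} (X : Fin n → Finset (Fin m)) (g : ℕ) : ℕ :=
  if h : g < m then ∑ i : Fin n, if (⟨g, h⟩ : Fin m) ∈ X i then (i : ℕ) + 1 else 0 else 0

/-- The bundles described by an array of owners. -/
def decodeAlloc (n m : ℕ) (a : ℕ → ℕ) (i : Fin n) : Finset (Fin m) :=
  Finset.univ.filter fun g => a g = (i : ℕ) + 1

theorem decodeAlloc_encodeAlloc {n m : ℕ} (X : Fin n → Finset (Fin m)) (hX : IsAllocation X) :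
    decodeAlloc n m (encodeAlloc X) = X := by
  funext i
  ext g
  have key : ∀ j : Fin n, g ∈ X j → encodeAlloc X g = (j : ℕ) + 1 := by
    intro j hj
    simp only [encodeAlloc, g.isLt, dite_true]
    rw [Finset.sum_eq_single j]
    · simp [hj]
    · intro k _ hk
      simp [Finset.disjoint_right.1 (hX k j hk) hj]
    · simp
  simp only [decodeAlloc, Finset.mem_filter, Finset.mem_univ, true_and]
  refine ⟨fun h => ?_, key i⟩
  by_contra hi
  by_cases hex : ∃ j, g ∈ X j
  · obtain ⟨j, hj⟩ := hex
    have hji : j = i := by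
      apply Fin.ext
      have := key j hj
      omega
    exact hi (hji ▸ hj)
  · push Not at hex
    simp [encodeAlloc, hex] at h

/-- The start state: natural registers `0` and `1` hold the numbers of agents and of items, natural
array `0` holds the given allocation, and everything else is `0`. -/
def startState {n m : ℕ} (X : Fin n → Finset (Fin m)) : State where
  nreg := fun x => if x = 0 then n else if x = 1 then m else 0
  rreg := fun _ => 0
  narr := fun a g => if a = 0 then encodeAlloc X g else 0
  rarr := fun _ _ => 0

/-- The allocation described by natural array `0`. -/
def State.output (s : State) (n m : ℕ) : Fin n → Finset (Fin m) :=
  decodeAlloc n m (s.narr 0)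

end FairDiv

/-! Bundles carry the labels of their original owners. During a phase, some agents are matched to
reduced bundles Z_b ⊆ X_b. An unmatched agent c compares Z_c with the best Z_b \ {g}, b ≠ c. If Z_c
is worth at least α times that, she takes Z_c; otherwise she takes Z_b \ {g}, and g leaves the
bundle. A former holder becomes unmatched. Since c chooses a maximum and bundles only shrink, every
matched agent stays α-EFX satisfied, and an agent a matched to some b ≠ a has v_a(Z_a) ≤ α v_a(Z_b)
(`IsPhase.take_own`, `IsPhase.take_other`).

Suppose all agents get matched while each owner still has v_a(Z_a) ≥ v_a(X_a) / ((1 + α)(1 +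
α/(2n))). Each agent then holds at least this much. The bundle taken last was unheld, hence intact,
until that moment, so its owner holds at least v_a(X_a). Her saved factor 1 + α pays for the slack
of the other n - 1 agents, as (1 + α/(2n))^(n-1) ≤ 1 + α. The product of values has dropped by at
most (1 + α)^n (`IsLoopState.welfare_output`).

Suppose instead that bundle b falls below the threshold. Follow b to its holder, then to the bundle
of that agent, and so on; give each reduced bundle on this walk to its holder, while removed items
stay with their owners (`IsPhase.rebalance`). If the walk returns to b, nobody loses value even when
the item just removed is discarded. Otherwise it ends at an unheld, intact bundle j. Agent j keeps
X_j and gains at least v_j(X_j)/α, a factor (1 + α)/α, while b keeps the removed items, slightly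
more than a fraction α/(1 + α) of X_b. The slack turns this into a gain of a factor 1 + 1/(3n) in
the product.

The new allocation starts a new phase. Items are discarded at most m times. The product starts
within a factor β^n of its maximum, so by Bernoulli it can grow at most n² ⌈3/β⌉ times
(`inv_pow_le_of_three_div_le`). Within a phase, each move removes an item or settles an agent with
her own bundle. Thus β enters only the analysis, and linearly in 1/β. -/

namespace FairDiv

/-! ### Values of labelled bundles -/

open Finset in
/-- The value of agent `a` for the items with label `b`. -/
noncomputable def bundleValue (m : ℕ) (w : ℕ → ℕ → ℝ) (z : ℕ → ℕ) (a b : ℕ) : ℝ :=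
  ∑ g ∈ range m, if z g = b then w a g else 0

theorem bundleValue_nonneg {m : ℕ} {w : ℕ → ℕ → ℝ} (hw : ∀ a g, 0 ≤ w a g) (z : ℕ → ℕ)
    (a b : ℕ) : 0 ≤ bundleValue m w z a b :=
  Finset.sum_nonneg fun g _ => by split_ifs <;> simp [hw]

theorem bundleValue_congr {m : ℕ} {w : ℕ → ℕ → ℝ} {z z' : ℕ → ℕ} {b : ℕ}
    (h : ∀ g < m, z g = b ↔ z' g = b) (a : ℕ) :
    bundleValue m w z a b = bundleValue m w z' a b :=
  Finset.sum_congr rfl fun g hg => by simp only [h g (Finset.mem_range.1 hg)]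

theorem bundleValue_le_of_subset {m : ℕ} {w : ℕ → ℕ → ℝ} (hw : ∀ a g, 0 ≤ w a g) {z z' : ℕ → ℕ}
    {b : ℕ} (h : ∀ g < m, z g = b → z' g = b) (a : ℕ) :
    bundleValue m w z a b ≤ bundleValue m w z' a b := by
  refine Finset.sum_le_sum fun g hg => ?_
  have := h g (Finset.mem_range.1 hg)
  have := hw a g
  split_ifs <;> simp_all

theorem bundleValue_remove {m : ℕ} {w : ℕ → ℕ → ℝ} {z : ℕ → ℕ} {g₀ : ℕ} (hg₀ : g₀ < m)
    (hz : z g₀ ≠ 0) (a : ℕ) :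
    bundleValue m w (Function.update z g₀ 0) a (z g₀) = bundleValue m w z a (z g₀) - w a g₀ := by
  unfold bundleValue
  rw [← Finset.add_sum_erase _ _ (Finset.mem_range.2 hg₀),
    ← Finset.add_sum_erase (Finset.range m) (fun g => if z g = z g₀ then w a g else 0)
      (Finset.mem_range.2 hg₀)]
  simp only [Function.update_self, if_neg hz.symm, if_true, zero_add, add_sub_cancel_left]
  refine Finset.sum_congr rfl fun g hg => ?_
  rw [Function.update_of_ne (Finset.ne_of_mem_erase hg)]

theorem bundleValue_remove_of_ne {m : ℕ} {w : ℕ → ℕ → ℝ} {z : ℕ → ℕ} {g₀ b : ℕ} (hb : b ≠ 0)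
    (hne : b ≠ z g₀) (a : ℕ) :
    bundleValue m w (Function.update z g₀ 0) a b = bundleValue m w z a b := by
  refine bundleValue_congr (fun g _ => ?_) a
  by_cases h : g = g₀
  · subst h
    simp [hb.symm, hne.symm]
  · rw [Function.update_of_ne h]

theorem bundleValue_remove_le {m : ℕ} {w : ℕ → ℕ → ℝ} (hw : ∀ a g, 0 ≤ w a g) {z : ℕ → ℕ}
    {g₀ b : ℕ} (hb : b ≠ 0) (a : ℕ) :
    bundleValue m w (Function.update z g₀ 0) a b ≤ bundleValue m w z a b := by
  refine bundleValue_le_of_subset hw (fun g _ => ?_) a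
  by_cases h : g = g₀
  · subst h
    simp [hb.symm]
  · rw [Function.update_of_ne h]
    exact id

/-! ### Partial matchings between bundles and agents -/

/-- `hold` and `mate` describe a partial matching between the bundles `1, …, n` and the agents
`1, …, n`; the value `0` stands for unmatched. -/
structure IsMatching (n : ℕ) (hold mate : ℕ → ℕ) : Prop where
  hold_zero : hold 0 = 0
  hold_le : ∀ b ∈ Finset.Icc 1 n, hold b ≤ n
  mate_le : ∀ a ∈ Finset.Icc 1 n, mate a ≤ n
  mate_iff : ∀ a ∈ Finset.Icc 1 n, ∀ b ∈ Finset.Icc 1 n, (mate a = b ↔ hold b = a)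

namespace IsMatching

variable {n : ℕ} {hold mate : ℕ → ℕ}

theorem hold_mem (h : IsMatching n hold mate) {b : ℕ} (hb : b ∈ Finset.Icc 1 n)
    (h0 : hold b ≠ 0) : hold b ∈ Finset.Icc 1 n :=
  Finset.mem_Icc.2 ⟨Nat.one_le_iff_ne_zero.2 h0, h.hold_le b hb⟩

theorem mate_hold (h : IsMatching n hold mate) {b : ℕ} (hb : b ∈ Finset.Icc 1 n)
    (h0 : hold b ≠ 0) : mate (hold b) = b :=
  (h.mate_iff _ (h.hold_mem hb h0) _ hb).2 rfl

theorem hold_ne_of_unmatched (h : IsMatching n hold mate) {b c : ℕ} (hb : b ∈ Finset.Icc 1 n)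
    (hc : c ∈ Finset.Icc 1 n) (hc0 : mate c = 0) : hold b ≠ c := by
  intro e
  have := (h.mate_iff c hc b hb).2 e
  simp only [Finset.mem_Icc] at hb
  omega

/-- If all bundles are held, then all agents are matched. -/
theorem mate_ne_zero_of_forall_hold (h : IsMatching n hold mate)
    (hall : ∀ b ∈ Finset.Icc 1 n, hold b ≠ 0) : ∀ a ∈ Finset.Icc 1 n, mate a ≠ 0 := by
  intro a ha h0
  have hinj : Set.InjOn hold (Finset.Icc 1 n : Finset ℕ) := fun b hb b' hb' e => by
    rw [← h.mate_hold hb (hall b hb), e, h.mate_hold hb' (hall b' hb')]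
  have hmaps : Set.MapsTo hold (Finset.Icc 1 n : Finset ℕ) (Finset.Icc 1 n : Finset ℕ) :=
    fun b hb => h.hold_mem hb (hall b hb)
  obtain ⟨b, hb, e⟩ := Finset.surjOn_of_injOn_of_card_le hold hmaps hinj le_rfl ha
  exact h.hold_ne_of_unmatched hb ha h0 e

/-- The unmatched agent `c` takes bundle `b`, and its former holder becomes unmatched. -/
theorem reassign (h : IsMatching n hold mate) {b c : ℕ} (hb : b ∈ Finset.Icc 1 n)
    (hc : c ∈ Finset.Icc 1 n) (hc0 : mate c = 0) :
    IsMatching n (Function.update hold b c)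
      (Function.update (Function.update mate (hold b) 0) c b) := by
  have hne := h.hold_ne_of_unmatched hb hc hc0
  simp only [Finset.mem_Icc] at hb hc
  refine ⟨?_, fun b' hb' => ?_, fun a ha => ?_, fun a ha b' hb' => ?_⟩
  · rw [Function.update_of_ne (by omega), h.hold_zero]
  · have := h.hold_le b' hb'
    rw [Function.update_apply]
    split_ifs <;> omega
  · have := h.mate_le a ha
    simp only [Function.update_apply]
    split_ifs <;> omega
  · have h1 := h.mate_iff a ha b' hb'
    have h2 := h.mate_iff a ha b (Finset.mem_Icc.2 hb)
    have h3 := h.mate_iff c (Finset.mem_Icc.2 hc) b' hb'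
    simp only [Finset.mem_Icc] at ha hb'
    simp only [Function.update_apply]
    by_cases e1 : a = c
    · subst e1
      by_cases e2 : b' = b
      · simp [e2]
      · simp only [if_true, if_neg e2]
        omega
    · by_cases e2 : b' = b
      · subst e2
        simp only [if_true, if_neg e1]
        split_ifs <;> omega
      · simp only [if_neg e1, if_neg e2]
        split_ifs with e3
        · subst e3
          constructor
          · omega
          · intro e
            have := h1.2 e
            have := h2.2 rfl
            omega
        · exact h1

end IsMatching

/-! ### The matching phase -/

/-- The invariant of the matching phase, for the allocation `x`: bundle `b` has been reduced to the
items labelled `b` by `z`, and the reduced bundles are partially matched to the agents. -/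
structure IsPhase (n m : ℕ) (w : ℕ → ℕ → ℝ) (α : ℝ) (x z hold mate : ℕ → ℕ) : Prop where
  matching : IsMatching n hold mate
  owner_le : ∀ g < m, x g ≤ n
  sub : ∀ g < m, z g = 0 ∨ z g = x g
  unheld : ∀ b, hold b = 0 → ∀ g < m, x g = b → z g = b
  prefer : ∀ a ∈ Finset.Icc 1 n, mate a ≠ 0 → mate a ≠ a →
    bundleValue m w z a a ≤ α * bundleValue m w z a (mate a)
  efx : ∀ a ∈ Finset.Icc 1 n, mate a ≠ 0 → ∀ g < m, z g ≠ 0 →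
    α * (bundleValue m w z a (z g) - w a g) ≤ bundleValue m w z a (mate a)
  surplus : (∃ b ∈ Finset.Icc 1 n, hold b = 0) ∨ n = 0 ∨
    ∃ a ∈ Finset.Icc 1 n, bundleValue m w x a a ≤ bundleValue m w z a (mate a)

/-- No owner has lost more than a fraction slightly above `1 - 1 / (α + 1)` of her bundle. -/
def IsLarge (n m : ℕ) (w : ℕ → ℕ → ℝ) (α : ℝ) (x z : ℕ → ℕ) (a : ℕ) : Prop :=
  2 * n * bundleValue m w x a a ≤ (2 * n + α) * ((1 + α) * bundleValue m w z a a)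

section Phase

variable {n m : ℕ} {w : ℕ → ℕ → ℝ} {α : ℝ} {x z hold mate : ℕ → ℕ}

theorem IsPhase.init (hx : ∀ g < m, x g ≤ n) (hz : ∀ g < m, z g = x g) (hh : ∀ b ≤ n, hold b = 0)
    (hm : ∀ a ∈ Finset.Icc 1 n, mate a = 0) : IsPhase n m w α x z hold mate where
  matching := by
    refine ⟨hh 0 (Nat.zero_le _), fun b hb => ?_, fun a ha => ?_, fun a ha b hb => ?_⟩
    · rw [hh b (Finset.mem_Icc.1 hb).2]
      exact Nat.zero_le _
    · rw [hm a ha]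
      exact Nat.zero_le _
    · rw [hm a ha, hh b (Finset.mem_Icc.1 hb).2]
      simp only [Finset.mem_Icc] at ha hb
      omega
  owner_le := hx
  sub g hg := Or.inr (hz g hg)
  unheld b _ g hg hxg := by rw [hz g hg, hxg]
  prefer a ha h := absurd (hm a ha) h
  efx a ha h := absurd (hm a ha) h
  surplus := by
    rcases Nat.eq_zero_or_pos n with h | h
    · exact Or.inr (Or.inl h)
    · exact Or.inl ⟨1, Finset.mem_Icc.2 ⟨le_rfl, h⟩, hh 1 h⟩

theorem IsLarge.init (hw : ∀ a g, 0 ≤ w a g) (hα : 0 ≤ α) (hz : ∀ g < m, z g = x g) (a : ℕ) :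
    IsLarge n m w α x z a := by
  have h : bundleValue m w z a a = bundleValue m w x a a :=
    bundleValue_congr (fun g hg => by rw [hz g hg]) a
  have hn := bundleValue_nonneg (m := m) hw x a a
  unfold IsLarge
  rw [h]
  nlinarith [mul_nonneg hα hn, mul_nonneg hα (mul_nonneg hα hn),
    mul_nonneg (Nat.cast_nonneg (α := ℝ) n) (mul_nonneg hα hn)]

/-- If taking bundle `b` leaves no bundle unheld, then some agent holds a bundle that is worth at
least as much as her original one. -/
theorem IsPhase.surplus_reassign (hw : ∀ a g, 0 ≤ w a g) (hα1 : α ≤ 1)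
    (h : IsPhase n m w α x z hold mate) {b c : ℕ} (hb : b ∈ Finset.Icc 1 n)
    (hc : c ∈ Finset.Icc 1 n) (hc0 : mate c = 0) {z' : ℕ → ℕ}
    (hz' : ∀ y ≠ 0, y ≠ b ∨ b = c → ∀ g < m, z' g = y ↔ z g = y) :
    (∃ b' ∈ Finset.Icc 1 n, Function.update hold b c b' = 0) ∨ n = 0 ∨
    ∃ a ∈ Finset.Icc 1 n, bundleValue m w x a a ≤ bundleValue m w z' a
      (Function.update (Function.update mate (hold b) 0) c b a) := by
  by_cases hex : ∃ b' ∈ Finset.Icc 1 n, Function.update hold b c b' = 0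
  · exact Or.inl hex
  push Not at hex
  right; right
  have hM := h.matching.reassign hb hc hc0
  have hmate := hM.mate_ne_zero_of_forall_hold hex
  -- Before the move `c` was unmatched, so some bundle was unheld; as only `b` changes hands, it was
  -- `b`.
  have hb0 : hold b = 0 := by
    by_contra hne
    refine h.matching.mate_ne_zero_of_forall_hold (fun b' hb' => ?_) c hc hc0
    by_cases e : b' = b
    · rwa [e]
    · have := hex b' hb'
      rwa [Function.update_of_ne e] at this
  have hxz : bundleValue m w x b b = bundleValue m w z b b := by
    refine bundleValue_congr (fun g hg => ⟨h.unheld b hb0 g hg, fun e => ?_⟩) b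
    have := h.sub g hg
    have := (Finset.mem_Icc.1 hb).1
    omega
  have hbz : b ≠ 0 := by
    have := (Finset.mem_Icc.1 hb).1
    omega
  -- The witness is the owner of the bundle taken last. Either she takes it herself, or she is
  -- matched elsewhere and `prefer` compares her bundle with the intact `b`.
  refine ⟨b, hb, ?_⟩
  by_cases e : b = c
  · subst e
    rw [Function.update_self, hxz]
    exact (bundleValue_congr (fun g hg => (hz' b hbz (Or.inr rfl) g hg).symm) b).le
  · have e1 := hmate b hb
    rw [Function.update_of_ne e, hb0, Function.update_of_ne hbz] at e1 ⊢
    have e2 : mate b ≠ b := fun e2 => by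
      have := (h.matching.mate_iff b hb b hb).1 e2
      omega
    have h1 := h.prefer b hb e1 e2
    have h2 : bundleValue m w z' b (mate b) = bundleValue m w z b (mate b) :=
      bundleValue_congr (fun g hg => hz' _ e1 (Or.inl e2) g hg) b
    rw [h2, hxz]
    nlinarith [bundleValue_nonneg (m := m) hw z b (mate b)]

/-- No bundle changes, so only `c` needs a check. The bundles of others are covered by `hown`, and
her own because α ≤ 1. -/
theorem IsPhase.take_own (hw : ∀ a g, 0 ≤ w a g) (hα : 0 ≤ α) (hα1 : α ≤ 1)
    (h : IsPhase n m w α x z hold mate) {c : ℕ}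
    (hc : c ∈ Finset.Icc 1 n) (hc0 : mate c = 0)
    (hown : ∀ g < m, z g ≠ 0 → z g ≠ c →
      α * (bundleValue m w z c (z g) - w c g) ≤ bundleValue m w z c c) :
    IsPhase n m w α x z (Function.update hold c c)
      (Function.update (Function.update mate (hold c) 0) c c) where
  matching := h.matching.reassign hc hc hc0
  owner_le := h.owner_le
  sub := h.sub
  unheld b hb := by
    by_cases e : b = c
    · rw [e, Function.update_self] at hb
      simp only [Finset.mem_Icc] at hc
      omega
    · rw [Function.update_of_ne e] at hb
      exact h.unheld b hb
  prefer a ha := by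
    by_cases e : a = c
    · simp [e]
    · rw [Function.update_of_ne e]
      by_cases e' : a = hold c
      · simp [e']
      · rw [Function.update_of_ne e']
        exact h.prefer a ha
  efx a ha := by
    by_cases e : a = c
    · rw [e, Function.update_self]
      intro _ g hg hz
      by_cases e' : z g = c
      · rw [e']
        have := bundleValue_nonneg (m := m) hw z c c
        nlinarith [mul_nonneg hα (hw c g)]
      · exact hown g hg hz e'
    · rw [Function.update_of_ne e]
      by_cases e' : a = hold c
      · simp [e']
      · rw [Function.update_of_ne e']
        exact h.efx a ha
  surplus := h.surplus_reassign hw hα1 hc hc hc0 fun _ _ _ _ _ => Iff.rfl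

/-- The strict inequality `hlt` is `prefer` for `c`, and maximality of `g₀` gives `efx` for `c`. For
other matched agents the bundle they hold is untouched, because only label `z g₀` loses an item and
its former holder is displaced, while all other bundles can only have shrunk. -/
theorem IsPhase.take_other (hw : ∀ a g, 0 ≤ w a g) (hα : 0 ≤ α) (hα1 : α ≤ 1)
    (h : IsPhase n m w α x z hold mate) {c g₀ : ℕ}
    (hc : c ∈ Finset.Icc 1 n) (hc0 : mate c = 0) (hg₀ : g₀ < m) (hz0 : z g₀ ≠ 0) (hzc : z g₀ ≠ c)
    (hlt : bundleValue m w z c c < α * (bundleValue m w z c (z g₀) - w c g₀))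
    (hmax : ∀ g < m, z g ≠ 0 → z g ≠ c →
      bundleValue m w z c (z g) - w c g ≤ bundleValue m w z c (z g₀) - w c g₀) :
    IsPhase n m w α x (Function.update z g₀ 0) (Function.update hold (z g₀) c)
      (Function.update (Function.update mate (hold (z g₀)) 0) c (z g₀)) := by
  have hb : z g₀ ∈ Finset.Icc 1 n := by
    have h1 := h.sub g₀ hg₀
    have h2 := h.owner_le g₀ hg₀
    rw [Finset.mem_Icc]
    omega
  have hcz : c ≠ 0 := by
    simp only [Finset.mem_Icc] at hc
    omega
  have hnn := bundleValue_nonneg (m := m) hw z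
  have hz'ne : ∀ g, Function.update z g₀ 0 g ≠ 0 → g ≠ g₀ ∧ Function.update z g₀ 0 g = z g := by
    intro g hg
    by_cases e : g = g₀
    · simp [e] at hg
    · exact ⟨e, Function.update_of_ne e _ _⟩
  have hM := h.matching.reassign hb hc hc0
  have hmb : ∀ a ∈ Finset.Icc 1 n, a ≠ hold (z g₀) → mate a ≠ z g₀ := by
    intro a ha hne e
    exact hne ((h.matching.mate_iff a ha _ hb).1 e).symm
  refine ⟨hM, h.owner_le, fun g hg => ?_, fun b hb' g hg hx => ?_, fun a ha => ?_, fun a ha => ?_, ?_⟩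
  · by_cases e : g = g₀
    · simp [e]
    · rw [Function.update_of_ne e]
      exact h.sub g hg
  · by_cases e : b = z g₀
    · rw [e, Function.update_self] at hb'
      omega
    · rw [Function.update_of_ne e] at hb'
      have := h.unheld b hb' g hg hx
      rw [Function.update_of_ne]
      · exact this
      · rintro rfl
        exact e this.symm
  · by_cases e : a = c
    · subst e
      rw [Function.update_self]
      intro _ _
      rw [bundleValue_remove_of_ne hcz (Ne.symm hzc), bundleValue_remove hg₀ hz0]
      exact hlt.le
    · rw [Function.update_of_ne e]
      by_cases e' : a = hold (z g₀)
      · simp [e']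
      · rw [Function.update_of_ne e']
        intro h1 h2
        rw [bundleValue_remove_of_ne h1 (hmb a ha e')]
        refine (bundleValue_remove_le hw ?_ a).trans (h.prefer a ha h1 h2)
        simp only [Finset.mem_Icc] at ha
        omega
  · by_cases e : a = c
    · subst e
      rw [Function.update_self, bundleValue_remove hg₀ hz0]
      intro _ g hg hz
      obtain ⟨hne, e2⟩ := hz'ne g hz
      rw [e2] at hz ⊢
      have h1 := bundleValue_remove_le (m := m) (z := z) (g₀ := g₀) hw hz a
      have h3 := hw a g
      have h4 := hnn a a
      set B := bundleValue m w z a (z g₀) - w a g₀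
      -- Nonnegativity of `B` allows α · B ≤ B, which compares the envied bundles with what `c` now
      -- holds.
      have hB : 0 ≤ B := by
        by_contra hB
        nlinarith
      by_cases e3 : z g = a
      · rw [e3] at h1 ⊢
        nlinarith
      · have h2 := hmax g hg hz e3
        nlinarith
    · rw [Function.update_of_ne e]
      by_cases e' : a = hold (z g₀)
      · simp [e']
      · rw [Function.update_of_ne e']
        intro h1 g hg hz
        obtain ⟨hne, e2⟩ := hz'ne g hz
        rw [e2] at hz ⊢
        rw [bundleValue_remove_of_ne h1 (hmb a ha e')]
        have h2 := bundleValue_remove_le (m := m) (z := z) (g₀ := g₀) hw hz a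
        have h3 := h.efx a ha h1 g hg hz
        nlinarith
  · refine h.surplus_reassign hw hα1 hb hc hc0 fun y hy hyb g hg => ?_
    have hyb : y ≠ z g₀ := hyb.resolve_right hzc
    by_cases e : g = g₀
    · subst e
      simp [hy.symm, hyb.symm]
    · rw [Function.update_of_ne e]

end Phase

/-! ### Walks along the holders -/

/-- A partially completed walk from bundle `b` along the holders: `nw` sends every bundle left so
far to its holder and fixes all others, and `j` is the current bundle. -/
structure IsWalk (n : ℕ) (hold : ℕ → ℕ) (b : ℕ) (nw : ℕ → ℕ) (j : ℕ) : Prop where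
  start : nw b ≠ b
  mem : j ∈ Finset.Icc 1 n
  giver : ∀ y ∈ Finset.Icc 1 n, nw y ≠ y → nw y = hold y ∧ nw y ∈ Finset.Icc 1 n
  receiver : ∀ y ∈ Finset.Icc 1 n, nw y ≠ y → y ≠ b → ∃ u ∈ Finset.Icc 1 n, u ≠ y ∧ nw u = y
  current : ∃ u ∈ Finset.Icc 1 n, u ≠ j ∧ nw u = j
  fresh : j = b ∨ nw j = j

namespace IsWalk

variable {n b j : ℕ} {hold mate nw : ℕ → ℕ}

theorem init (h : IsMatching n hold mate) (hb : b ∈ Finset.Icc 1 n) (h0 : hold b ≠ 0)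
    (hne : hold b ≠ b) (hid : ∀ y ∈ Finset.Icc 1 n, nw y = y) :
    IsWalk n hold b (Function.update nw b (hold b)) (hold b) := by
  have hm := h.hold_mem hb h0
  refine ⟨by simpa using hne, hm, fun y hy hy' => ?_, fun y hy hy' hyb => ?_,
    ⟨b, hb, hne.symm, Function.update_self ..⟩, Or.inr ?_⟩
  · by_cases e : y = b
    · subst e
      simpa using hm
    · rw [Function.update_of_ne e] at hy'
      exact absurd (hid y hy) hy'
  · rw [Function.update_of_ne hyb] at hy'
    exact absurd (hid y hy) hy'
  · rw [Function.update_of_ne hne, hid _ hm]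

theorem eq_of_hold_eq (h : IsMatching n hold mate) {u v : ℕ} (hu : u ∈ Finset.Icc 1 n)
    (hv : v ∈ Finset.Icc 1 n) (h0 : hold u ≠ 0) (e : hold u = hold v) : u = v := by
  rw [← h.mate_hold hu h0, e, h.mate_hold hv (e ▸ h0)]

/-- Agent `j` already holds the preceding bundle of the walk, and nobody holds two bundles. -/
theorem hold_current_ne (hw : IsWalk n hold b nw j) (h : IsMatching n hold mate) (h0 : hold j ≠ 0) :
    hold j ≠ j := by
  intro e
  obtain ⟨u, hu, huj, hnu⟩ := hw.current
  have h1 := (hw.giver u hu (by rw [hnu]; exact huj.symm)).1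
  exact huj (eq_of_hold_eq h hw.mem hu h0 (by rw [e, ← h1, hnu])).symm

/-- As `hold` is injective on held bundles, the walk cannot run into itself except at its starting
point `b`, which has no predecessor on the walk until then. -/
theorem step (hw : IsWalk n hold b nw j) (h : IsMatching n hold mate) (hjb : j ≠ b)
    (h0 : hold j ≠ 0) : IsWalk n hold b (Function.update nw j (hold j)) (hold j) := by
  have hm := h.hold_mem hw.mem h0
  have hne := hw.hold_current_ne h h0
  have hj := hw.fresh.resolve_left hjb
  refine ⟨by rw [Function.update_of_ne hjb.symm]; exact hw.start, hm, fun y hy hy' => ?_,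
    fun y hy hy' hyb => ?_, ⟨j, hw.mem, hne.symm, Function.update_self ..⟩, ?_⟩
  · by_cases e : y = j
    · subst e
      simpa using hm
    · rw [Function.update_of_ne e] at hy' ⊢
      exact hw.giver y hy hy'
  · by_cases e : y = j
    · subst e
      obtain ⟨u, hu, huj, hnu⟩ := hw.current
      exact ⟨u, hu, huj, by rwa [Function.update_of_ne huj]⟩
    · rw [Function.update_of_ne e] at hy'
      obtain ⟨u, hu, huj, hnu⟩ := hw.receiver y hy hy' hyb
      refine ⟨u, hu, huj, ?_⟩
      rw [Function.update_of_ne]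
      · exact hnu
      · rintro rfl
        rw [hj] at hnu
        exact huj hnu
  -- If the next bundle had been visited, its predecessor `u` would have the same holder as `j`,
  -- hence be `j`; but `nw` still fixes `j`.
  · by_contra hcon
    push Not at hcon
    rw [Function.update_of_ne hne] at hcon
    obtain ⟨u, hu, huj, hnu⟩ := hw.receiver _ hm hcon.2 hcon.1
    have h1 := (hw.giver u hu (by rw [hnu]; exact huj.symm)).1
    have h2 := eq_of_hold_eq h hw.mem hu h0 (by rw [← hnu, h1])
    rw [← h2, hj] at hnu
    exact hne hnu.symm

/-- This is the termination measure of the walk: each step makes `nw` move one more bundle. -/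
theorem card_fixed_lt (hw : IsWalk n hold b nw j) (h : IsMatching n hold mate) (hjb : j ≠ b)
    (h0 : hold j ≠ 0) :
    ((Finset.Icc 1 n).filter fun y => Function.update nw j (hold j) y = y).card <
      ((Finset.Icc 1 n).filter fun y => nw y = y).card := by
  have hne := hw.hold_current_ne h h0
  have hj := hw.fresh.resolve_left hjb
  refine Finset.card_lt_card (Finset.ssubset_iff_of_subset ?_ |>.2 ⟨j, ?_, ?_⟩)
  · intro y hy
    simp only [Finset.mem_filter] at hy ⊢
    refine ⟨hy.1, ?_⟩
    by_cases e : y = j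
    · rwa [e]
    · rw [Function.update_of_ne e] at hy
      exact hy.2
  · exact Finset.mem_filter.2 ⟨hw.mem, hj⟩
  · simp [hne]

end IsWalk

/-! ### Shifting bundles along a walk and the gain in welfare -/

section Shift

variable {n m : ℕ} {w : ℕ → ℕ → ℝ} {α : ℝ} {x x' z nw : ℕ → ℕ} {a u : ℕ}

/-- An agent can lose only her own reduced bundle, and only if `nw` moves it. The last two
alternatives of `hx'` leave free the new owner of an item that was never hers or that she gives away
anyway; this accommodates a discarded item. -/
theorem bundleValue_shift (hw : ∀ a g, 0 ≤ w a g) (ha : a ≠ 0)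
    (hsub : ∀ g < m, z g = 0 ∨ z g = x g)
    (hx' : ∀ g < m, x' g = (if z g = 0 then x g else nw (z g)) ∨ (z g = 0 ∧ x g ≠ a) ∨
      (z g = a ∧ nw a ≠ a)) :
    bundleValue m w x a a ≤
      bundleValue m w x' a a + if nw a = a then 0 else bundleValue m w z a a := by
  have : (if nw a = a then 0 else bundleValue m w z a a) =
      ∑ g ∈ Finset.range m, if nw a ≠ a ∧ z g = a then w a g else 0 := by
    split_ifs with h
    · simp [h]
    · simp [h, bundleValue]
  rw [this, bundleValue, bundleValue, ← Finset.sum_add_distrib]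
  refine Finset.sum_le_sum fun g hg => ?_
  have h1 := hsub g (Finset.mem_range.1 hg)
  have h2 := hx' g (Finset.mem_range.1 hg)
  have h3 := hw a g
  by_cases c1 : z g = 0
  · rw [if_pos c1] at h2
    by_cases c2 : x g = a
    · have : x' g = a := by omega
      simp only [c2, this, if_true]
      split_ifs <;> linarith
    · rw [if_neg c2]
      split_ifs <;> linarith
  · rw [if_neg c1] at h2
    have c3 := h1.resolve_left c1
    by_cases c2 : x g = a
    · have c4 : z g = a := by omega
      by_cases c5 : nw a = a
      · have : x' g = a := by
          rw [c4] at h2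
          omega
        simp [c2, this, c5]
      · rw [if_pos c2, if_pos (⟨c5, c4⟩ : nw a ≠ a ∧ z g = a)]
        split_ifs <;> linarith
    · rw [if_neg c2]
      split_ifs <;> linarith

/-- The received items carry the label `u ≠ a` in `z`, so they were not hers before and their value
is a pure addition to the previous bound. -/
theorem bundleValue_shift_add (hw : ∀ a g, 0 ≤ w a g) (ha : a ≠ 0) (hu : u ≠ 0) (hua : u ≠ a)
    (hnu : nw u = a) (hsub : ∀ g < m, z g = 0 ∨ z g = x g)
    (hx' : ∀ g < m, x' g = (if z g = 0 then x g else nw (z g)) ∨ (z g = 0 ∧ x g ≠ a) ∨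
      (z g = a ∧ nw a ≠ a)) :
    bundleValue m w x a a + bundleValue m w z a u ≤
      bundleValue m w x' a a + if nw a = a then 0 else bundleValue m w z a a := by
  have : (if nw a = a then 0 else bundleValue m w z a a) =
      ∑ g ∈ Finset.range m, if nw a ≠ a ∧ z g = a then w a g else 0 := by
    split_ifs with h
    · simp [h]
    · simp [h, bundleValue]
  rw [this, bundleValue, bundleValue, bundleValue, ← Finset.sum_add_distrib,
    ← Finset.sum_add_distrib]
  refine Finset.sum_le_sum fun g hg => ?_
  have h1 := hsub g (Finset.mem_range.1 hg)
  have h2 := hx' g (Finset.mem_range.1 hg)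
  have h3 := hw a g
  by_cases c1 : z g = 0
  · rw [if_pos c1] at h2
    rw [if_neg (show ¬ z g = u by omega)]
    by_cases c2 : x g = a
    · have : x' g = a := by omega
      simp only [c2, this, if_true]
      split_ifs <;> linarith
    · rw [if_neg c2]
      split_ifs <;> linarith
  · rw [if_neg c1] at h2
    have c3 := h1.resolve_left c1
    by_cases c2 : x g = a
    · have c4 : z g = a := by omega
      rw [if_neg (show ¬ z g = u by omega)]
      by_cases c5 : nw a = a
      · have : x' g = a := by
          rw [c4] at h2
          omega
        simp [c2, this, c5]
      · rw [if_pos c2, if_pos (⟨c5, c4⟩ : nw a ≠ a ∧ z g = a)]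
        split_ifs <;> linarith
    · rw [if_neg c2]
      by_cases c6 : z g = u
      · have : x' g = a := by
          rw [c6, hnu] at h2
          omega
        simp only [c6, this, if_true]
        split_ifs <;> linarith
      · rw [if_neg c6]
        split_ifs <;> linarith

end Shift

/-- With `Z < 2nV / ((2n + α)(1 + α))`, what remains is `V' ≥ V - Z > αV(2n + 1 + α) / ((2n + α)(1 +
α))`. Multiplying by `U' ≥ U(1 + α)/α` leaves the factor `1 + 1/(2n + α)`, which is at least `1 +
1/(3n)` since `α ≤ 1 ≤ n`. -/
theorem mul_le_mul_of_large_loss {n α V V' Z U U' : ℝ} (hn : 1 ≤ n) (hα : 0 < α) (hα1 : α ≤ 1)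
    (hV : 0 < V) (hU : 0 < U) (hloss : (2 * n + α) * ((1 + α) * Z) < 2 * n * V)
    (hV' : V ≤ V' + Z) (hU' : (1 + α) * U ≤ α * U') :
    0 < V' ∧ (1 + 1 / (3 * n)) * (V * U) ≤ V' * U' := by
  have h1 : (2 * n + α) * ((1 + α) * V') ≥ (2 * n + α) * ((1 + 1 / (3 * n)) * (α * V)) := by
    have h2 : (2 * n + α) * (1 + 1 / (3 * n)) ≤ 2 * n + α + 1 := by
      have : (2 * n + α) * (1 / (3 * n)) ≤ 1 := by
        rw [mul_one_div, div_le_one (by linarith)]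
        linarith
      linarith
    have h3 : (2 * n + α) * (1 + 1 / (3 * n)) * (α * V) ≤ (2 * n + α + 1) * (α * V) :=
      mul_le_mul_of_nonneg_right h2 (by positivity)
    have h4 : (2 * n + α) * (1 + α) * V ≤ (2 * n + α) * (1 + α) * (V' + Z) :=
      mul_le_mul_of_nonneg_left hV' (by positivity)
    nlinarith
  have h5 : (1 + 1 / (3 * n)) * (α * V) ≤ (1 + α) * V' :=
    le_of_mul_le_mul_left h1 (by positivity)
  have h6 : 0 < V' := by
    have : 0 < (1 + 1 / (3 * n)) * (α * V) := by positivity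
    nlinarith
  refine ⟨h6, ?_⟩
  have h7 : α * ((1 + 1 / (3 * n)) * (V * U)) ≤ α * (V' * U') := by
    calc α * ((1 + 1 / (3 * n)) * (V * U)) = (1 + 1 / (3 * n)) * (α * V) * U := by ring
      _ ≤ (1 + α) * V' * U := mul_le_mul_of_nonneg_right h5 hU.le
      _ = V' * ((1 + α) * U) := by ring
      _ ≤ V' * (α * U') := mul_le_mul_of_nonneg_left hU' h6.le
      _ = α * (V' * U') := by ring
  exact le_of_mul_le_mul_left h7 hα

/-- The product of the values of the agents for their own bundles. -/
noncomputable def welfare (n m : ℕ) (w : ℕ → ℕ → ℝ) (x : ℕ → ℕ) : ℝ :=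
  ∏ a ∈ Finset.Icc 1 n, bundleValue m w x a a

/-- The number of items that are allocated. -/
def numAllocated (m : ℕ) (x : ℕ → ℕ) : ℕ :=
  ((Finset.range m).filter fun g => x g ≠ 0).card

/-- Every agent has an item of positive value. -/
def AllPositive (n m : ℕ) (w : ℕ → ℕ → ℝ) (x : ℕ → ℕ) : Prop :=
  ∀ a ∈ Finset.Icc 1 n, 0 < bundleValue m w x a a

section Rebalance

variable {n m : ℕ} {w : ℕ → ℕ → ℝ} {α : ℝ} {x x' z hold mate nw : ℕ → ℕ} {c g₀ j : ℕ}

/-- When `c` has taken a bundle from which too much has been removed, shifting the reduced bundles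
along the walk gives an allocation that has fewer items and no smaller welfare, or no more items and
a welfare that is larger by a factor `1 + 1 / (3 * n)`. -/
theorem IsPhase.rebalance (hw : ∀ a g, 0 ≤ w a g) (hα : 0 ≤ α) (hα1 : α ≤ 1)
    (h : IsPhase n m w α x z hold mate) (hpos : AllPositive n m w x)
    (hg₀ : g₀ < m) (hz0 : z g₀ ≠ 0) (hzc : z g₀ ≠ c)
    (hlt : bundleValue m w z c c < α * (bundleValue m w z c (z g₀) - w c g₀))
    (h' : IsPhase n m w α x (Function.update z g₀ 0) (Function.update hold (z g₀) c)
      (Function.update (Function.update mate (hold (z g₀)) 0) c (z g₀)))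
    (hloss : ¬ IsLarge n m w α x (Function.update z g₀ 0) (z g₀))
    (hwalk : IsWalk n (Function.update hold (z g₀) c) (z g₀) nw j)
    (hend : j = z g₀ ∨ Function.update hold (z g₀) c j = 0)
    (hx' : ∀ g < m, x' g = if g = g₀ ∧ j = z g₀ then 0 else
      if Function.update z g₀ 0 g = 0 then x g else nw (Function.update z g₀ 0 g)) :
    (∀ g < m, x' g ≤ n) ∧ AllPositive n m w x' ∧
      ((welfare n m w x ≤ welfare n m w x' ∧ numAllocated m x' < numAllocated m x) ∨
       ((1 + 1 / (3 * (n : ℝ))) * welfare n m w x ≤ welfare n m w x' ∧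
          numAllocated m x' ≤ numAllocated m x)) := by
  set b := z g₀ with hbdef
  set z' := Function.update z g₀ 0 with hz'def
  set hold' := Function.update hold b c
  set mate' := Function.update (Function.update mate (hold b) 0) c b
  have hxb : x g₀ = b := by
    have := h.sub g₀ hg₀
    omega
  have hb : b ∈ Finset.Icc 1 n := by
    have h2 := h.owner_le g₀ hg₀
    rw [Finset.mem_Icc]
    omega
  have hz'0 : z' g₀ = 0 := Function.update_self ..
  have hz'ne : ∀ g ≠ g₀, z' g = z g := fun g hg => Function.update_of_ne hg _ _
  have ne0 : ∀ y ∈ Finset.Icc 1 n, y ≠ 0 := fun y hy => by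
    simp only [Finset.mem_Icc] at hy
    omega
  have hnn := bundleValue_nonneg (m := m) hw
  -- For α = 0 no agent would ever have preferred the bundle of another one.
  have hα0 : 0 < α := by
    refine lt_of_le_of_ne hα fun e => ?_
    rw [← e, zero_mul] at hlt
    exact absurd hlt (not_lt.2 (hnn z c c))
  have hz'mem : ∀ g < m, z' g ≠ 0 → z' g ∈ Finset.Icc 1 n ∧ nw (z' g) ∈ Finset.Icc 1 n := by
    intro g hg hz
    have h1 : z' g ∈ Finset.Icc 1 n := by
      have h1 := h'.sub g hg
      have h2 := h'.owner_le g hg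
      rw [Finset.mem_Icc]
      omega
    refine ⟨h1, ?_⟩
    by_cases e : nw (z' g) = z' g
    · rwa [e]
    · exact (hwalk.giver _ h1 e).2
  have hle : ∀ g < m, x' g ≤ n := by
    intro g hg
    rw [hx' g hg]
    split_ifs with h1 h2
    · exact Nat.zero_le _
    · exact h.owner_le g hg
    · exact (Finset.mem_Icc.1 (hz'mem g hg h2).2).2
  have hdom : ∀ g < m, x' g ≠ 0 → x g ≠ 0 := by
    intro g hg hne
    rw [hx' g hg] at hne
    split_ifs at hne with h1 h2
    · exact absurd rfl hne
    · exact hne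
    · have := h'.sub g hg
      omega
  have hcard : numAllocated m x' ≤ numAllocated m x := by
    refine Finset.card_le_card fun g hg => ?_
    simp only [Finset.mem_filter, Finset.mem_range] at hg ⊢
    exact ⟨hg.1, hdom g hg.1 hg.2⟩
  -- a receiver is matched to the bundle that it receives
  have hmate' : ∀ a ∈ Finset.Icc 1 n, ∀ u ∈ Finset.Icc 1 n, u ≠ a → nw u = a → mate' a = u := by
    intro a ha u hu hne hnu
    refine (h'.matching.mate_iff a ha u hu).2 ?_
    rw [← hnu]
    exact (hwalk.giver u hu (by rw [hnu]; exact hne.symm)).1.symm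
  -- A discarded `g₀` belonged to `b`, so it does not matter to any other agent.
  have hshift : ∀ a ≠ b, ∀ g < m, x' g = (if z' g = 0 then x g else nw (z' g)) ∨
      (z' g = 0 ∧ x g ≠ a) ∨ (z' g = a ∧ nw a ≠ a) := by
    intro a hab g hg
    rw [hx' g hg]
    by_cases h1 : g = g₀ ∧ j = b
    · right; left
      rw [h1.1, hxb]
      exact ⟨hz'0, hab.symm⟩
    · left
      rw [if_neg h1]
  have hother : ∀ a ∈ Finset.Icc 1 n, a ≠ b →
      bundleValue m w x a a ≤ bundleValue m w x' a a := by
    intro a ha hab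
    by_cases e : nw a = a
    · have := bundleValue_shift hw (ne0 a ha) h'.sub (hshift a hab)
      rwa [if_pos e, add_zero] at this
    · obtain ⟨u, hu, hua, hnu⟩ := hwalk.receiver a ha e hab
      have h1 := bundleValue_shift_add hw (ne0 a ha) (ne0 u hu) hua hnu h'.sub (hshift a hab)
      rw [if_neg e] at h1
      have h2 := hmate' a ha u hu hua hnu
      have h3 := h'.prefer a ha (by rw [h2]; exact ne0 u hu) (by rw [h2]; exact hua)
      rw [h2] at h3
      have h4 := hnn z' a u
      nlinarith
  by_cases hjb : j = b
  · -- the walk has closed a cycle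
    obtain ⟨u, hu, huj, hnu⟩ := hwalk.current
    rw [hjb] at huj hnu
    have h1 : bundleValue m w x b b ≤ bundleValue m w x' b b := by
      -- Here the bundles before the removal of `g₀` are used: `b` gives away all of `z`-bundle `b`,
      -- and `g₀` is the part of it that goes to nobody.
      have h1 := bundleValue_shift_add (z := z) (x' := x') hw (ne0 b hb) (ne0 u hu) huj hnu h.sub
        fun g hg => by
          by_cases e : g = g₀
          · right; right
            rw [e]
            exact ⟨rfl, hwalk.start⟩
          · left
            rw [hx' g hg, if_neg (fun h => e h.1), hz'ne g e]
      rw [if_neg hwalk.start] at h1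
      have h2 := hmate' b hb u hu huj hnu
      have hbc : b ≠ c := hzc
      have h2' : Function.update mate (hold b) 0 b = u :=
        (Function.update_of_ne hbc _ _).symm.trans h2
      -- The last move matched only `c ≠ b`, so `b` held `u` already and preferred it to her bundle
      -- when that still contained `g₀`.
      have h3 : mate b = u := by
        rw [Function.update_apply] at h2'
        split_ifs at h2'
        · exact absurd h2'.symm (ne0 u hu)
        · exact h2'
      have h4 := h.prefer b hb (by rw [h3]; exact ne0 u hu) (by rw [h3]; exact huj)
      rw [h3] at h4
      have h5 := hnn z b u
      nlinarith
    have hall : ∀ a ∈ Finset.Icc 1 n, bundleValue m w x a a ≤ bundleValue m w x' a a := by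
      intro a ha
      by_cases e : a = b
      · rwa [e]
      · exact hother a ha e
    refine ⟨hle, fun a ha => (hpos a ha).trans_le (hall a ha), Or.inl ⟨?_, ?_⟩⟩
    · exact Finset.prod_le_prod (fun a _ => hnn x a a) hall
    · refine Finset.card_lt_card (Finset.ssubset_iff_of_subset ?_ |>.2 ⟨g₀, ?_, ?_⟩)
      · intro g hg
        simp only [Finset.mem_filter, Finset.mem_range] at hg ⊢
        exact ⟨hg.1, hdom g hg.1 hg.2⟩
      · simp only [Finset.mem_filter, Finset.mem_range]
        exact ⟨hg₀, by rw [hxb]; exact hz0⟩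
      · simp [hx' g₀ hg₀, hjb]
  · -- the walk has ended at an unheld bundle
    have hj0 := hend.resolve_left hjb
    obtain ⟨u, hu, huj, hnu⟩ := hwalk.current
    have h1 : bundleValue m w x b b ≤ bundleValue m w x' b b + bundleValue m w z' b b := by
      have h1 := bundleValue_shift (x' := x') hw (ne0 b hb) h'.sub fun g hg => by
        left
        rw [hx' g hg, if_neg (fun h => hjb h.2)]
      rwa [if_neg hwalk.start] at h1
    -- Bundle `j` is unheld, hence intact, and agent `j` gives nothing away; `prefer` bounds her
    -- whole old bundle by α times what she receives.
    have h2 : (1 + α) * bundleValue m w x j j ≤ α * bundleValue m w x' j j := by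
      have h2 := bundleValue_shift_add hw (ne0 j hwalk.mem) (ne0 u hu) huj hnu h'.sub
        (hshift j hjb)
      rw [if_pos (hwalk.fresh.resolve_left hjb)] at h2
      have h3 := hmate' j hwalk.mem u hu huj hnu
      have h4 := h'.prefer j hwalk.mem (by rw [h3]; exact ne0 u hu) (by rw [h3]; exact huj)
      have h5 : bundleValue m w x j j ≤ bundleValue m w z' j j :=
        bundleValue_le_of_subset hw (h'.unheld j hj0) j
      rw [h3] at h4
      nlinarith
    have hn : (1 : ℝ) ≤ n := by
      have := Finset.mem_Icc.1 hb
      exact_mod_cast this.1.trans this.2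
    obtain ⟨h3, h4⟩ := mul_le_mul_of_large_loss hn hα0 hα1 (hpos b hb) (hpos j hwalk.mem)
      (not_le.1 hloss) h1 h2
    refine ⟨hle, fun a ha => ?_, Or.inr ⟨?_, hcard⟩⟩
    · by_cases e : a = b
      · rwa [e]
      · exact (hpos a ha).trans_le (hother a ha e)
    · have hjm : j ∈ (Finset.Icc 1 n).erase b := Finset.mem_erase.2 ⟨hjb, hwalk.mem⟩
      unfold welfare
      rw [← Finset.mul_prod_erase _ _ hb, ← Finset.mul_prod_erase _ _ hjm,
        ← Finset.mul_prod_erase (Finset.Icc 1 n) (fun a => bundleValue m w x' a a) hb,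
        ← Finset.mul_prod_erase _ (fun a => bundleValue m w x' a a) hjm]
      rw [← mul_assoc (bundleValue m w x b b), ← mul_assoc, ← mul_assoc (bundleValue m w x' b b)]
      have hjj := (hpos j hwalk.mem).trans_le (hother j hwalk.mem hjb)
      refine mul_le_mul h4 ?_ ?_ ?_
      · refine Finset.prod_le_prod (fun a _ => hnn x a a) fun a ha => ?_
        simp only [Finset.mem_erase] at ha
        exact hother a ha.2.2 ha.2.1
      · exact Finset.prod_nonneg fun a _ => hnn x a a
      · exact mul_nonneg h3.le hjj.le

end Rebalance

/-! ### A calculus of time-bounded executions -/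

/-- `P`, started in `s`, halts within `B` steps in a state that satisfies `Q`. -/
def Runs (inp : ℕ → ℕ → ℝ) (P : Prog) (s : State) (B : ℕ) (Q : State → Prop) : Prop :=
  ∃ t s', Exec inp P s t s' ∧ t ≤ B ∧ Q s'

namespace Runs

variable {inp : ℕ → ℕ → ℝ} {P R : Prog} {s : State} {B B₁ B₂ : ℕ} {Q Q' : State → Prop} {b : Test}

theorem mono (h : Runs inp P s B₁ Q) (hB : B₁ ≤ B₂) (hQ : ∀ s', Q s' → Q' s') :
    Runs inp P s B₂ Q' := by
  obtain ⟨t, s', he, ht, hq⟩ := h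
  exact ⟨t, s', he, ht.trans hB, hQ s' hq⟩

theorem op {o : Op} (h : Q (o.apply inp s)) : Runs inp (.op o) s 1 Q :=
  ⟨1, _, .op o s, le_rfl, h⟩

theorem seq (h : Runs inp P s B₁ fun s₁ => Runs inp R s₁ B₂ Q) :
    Runs inp (.seq P R) s (B₁ + B₂) Q := by
  obtain ⟨t₁, s₁, h₁, ht₁, t₂, s₂, h₂, ht₂, hq⟩ := h
  exact ⟨t₁ + t₂, s₂, .seq h₁ h₂, Nat.add_le_add ht₁ ht₂, hq⟩

theorem ite (hP : b.Holds s → Runs inp P s B₁ Q) (hR : ¬ b.Holds s → Runs inp R s B₂ Q) :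
    Runs inp (.ite b P R) s (B₁ + B₂ + 1) Q := by
  by_cases hb : b.Holds s
  · obtain ⟨t, s', h, ht, hq⟩ := hP hb
    exact ⟨t + 1, s', .ite_true hb h, by omega, hq⟩
  · obtain ⟨t, s', h, ht, hq⟩ := hR hb
    exact ⟨t + 1, s', .ite_false hb h, by omega, hq⟩

/-- The index of the invariant is a measure that drops in each iteration. It is a relation and not a
function of the state, so it may depend on quantities that the machine does not store, such as the
remaining number of welfare gains. -/
theorem loop {Inv : ℕ → State → Prop}
    (hstep : ∀ μ s, Inv μ s → b.Holds s → Runs inp P s B fun s' => ∃ μ' < μ, Inv μ' s')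
    (μ : ℕ) (s : State) (h : Inv μ s) :
    Runs inp (.loop b P) s (μ * (B + 1) + 1) fun s' => ¬ b.Holds s' ∧ ∃ μ', Inv μ' s' := by
  induction μ using Nat.strong_induction_on generalizing s with
  | _ μ ih =>
    by_cases hb : b.Holds s
    · obtain ⟨t₁, s₁, h₁, ht₁, μ', hμ', hinv⟩ := hstep μ s h hb
      obtain ⟨t₂, s₂, h₂, ht₂, hq⟩ := ih μ' hμ' s₁ hinv
      refine ⟨t₁ + t₂ + 1, s₂, .loop_true hb h₁ h₂, ?_, hq⟩
      have : (μ' + 1) * (B + 1) ≤ μ * (B + 1) := Nat.mul_le_mul_right _ hμ'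
      rw [Nat.succ_mul] at this
      omega
    · exact ⟨1, s, .loop_false hb, by omega, hb, μ, h⟩

end Runs

/-- Overwriting one natural register. -/
def State.setN (s : State) (i k : ℕ) : State := { s with nreg := Function.update s.nreg i k }

/-- `for i = lo, …, N - 1`, with the bound in register `N` and the constant `1` in register `2`. -/
def forProg (i lo N : ℕ) (body : Prog) : Prog :=
  .seq (.op (.nconst i lo)) (.loop (.nlt i N) (.seq body (.op (.nadd i i 2))))

/-- The invariant for the next round is required after the counter has been advanced, so that it
applies to the state in which the next body starts. The body itself must leave the counter, the
bound and the constant `1` intact. -/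
theorem Runs.forProg {inp : ℕ → ℕ → ℝ} {i lo N K B : ℕ} {body : Prog} {s : State}
    (Inv : ℕ → State → Prop) (hiN : i ≠ N) (hi2 : i ≠ 2) (hlo : lo ≤ K) (hN : s.nreg N = K)
    (h2 : s.nreg 2 = 1) (hinit : Inv lo (s.setN i lo))
    (hbody : ∀ k s, lo ≤ k → k < K → Inv k s → s.nreg i = k → s.nreg N = K → s.nreg 2 = 1 →
      Runs inp body s B fun s' =>
        s'.nreg i = k ∧ s'.nreg N = K ∧ s'.nreg 2 = 1 ∧ Inv (k + 1) (s'.setN i (k + 1))) :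
    Runs inp (forProg i lo N body) s ((K + 1) * (B + 2)) (Inv K) := by
  have key := Runs.loop (inp := inp) (b := .nlt i N) (P := .seq body (.op (.nadd i i 2)))
    (B := B + 1)
    (Inv := fun μ s => ∃ k, lo ≤ k ∧ k + μ = K ∧ Inv k s ∧ s.nreg i = k ∧ s.nreg N = K ∧
      s.nreg 2 = 1) ?_ (K - lo) (s.setN i lo) ?_
  · refine (Runs.seq (Runs.op key)).mono ?_ ?_
    · have : (K - lo) * (B + 1 + 1) ≤ K * (B + 2) := Nat.mul_le_mul_right _ (Nat.sub_le _ _)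
      rw [Nat.succ_mul]
      omega
    · rintro s' ⟨hb, μ, k, -, h1, h3, h4, h5, -⟩
      have : ¬ s'.nreg i < s'.nreg N := hb
      have : k = K := by omega
      exact this ▸ h3
  · rintro μ s ⟨k, h1, h3, h4, h5, h6, h7⟩ hb
    have hb : s.nreg i < s.nreg N := hb
    refine Runs.seq ((hbody k s h1 (by omega) h4 h5 h6 h7).mono le_rfl ?_)
    rintro s' ⟨h8, h9, h10, h11⟩
    refine Runs.op ⟨μ - 1, by omega, k + 1, by omega, by omega, ?_⟩
    simp only [Op.apply, h8, h10, Function.update_self]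
    rw [Function.update_of_ne hiN.symm, Function.update_of_ne hi2.symm]
    exact ⟨h11, trivial, h9, h10⟩
  · refine ⟨lo, le_rfl, by omega, hinit, ?_⟩
    simp [State.setN, Function.update_of_ne hiN.symm, Function.update_of_ne hi2.symm, hN, h2]

/-! ### The subprograms -/

/-- A step that changes only a scratch register. -/
def skip : Prog := .op (.nconst 21 0)

/-- Real register `r` gets the value of the agent in register `x` for the items to which array `a`
assigns the label in register `y`. -/
def sumBundle (a x y r : ℕ) : Prog :=
  .seq (.op (.rconst r 0)) <| forProg 20 0 1 <|
    .seq (.op (.nload 21 a 20)) <|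
      .ite (.neq 21 y)
        (.seq (.op (.rconst 20 1)) <| .seq (.op (.rmulInput 20 20 x 20)) <| .op (.radd r r 20))
        skip

/-- The registers that are never changed after they have been set up. -/
structure IsReady (n m : ℕ) (s : State) : Prop where
  n_eq : s.nreg 0 = n
  m_eq : s.nreg 1 = m
  one_eq : s.nreg 2 = 1
  zero_eq : s.nreg 3 = 0
  succ_eq : s.nreg 4 = n + 1
  rzero_eq : s.rreg 0 = 0

/-- An input is read by multiplying the real constant `1` by it. Registers from `20` on are scratch,
so callers rely only on those below `20`. -/
theorem runs_sumBundle {inp : ℕ → ℕ → ℝ} {s : State} {m a x y r : ℕ} (hm : s.nreg 1 = m)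
    (h1 : s.nreg 2 = 1) (hx : x < 20) (hy : y < 20) (hr : r < 20) :
    Runs inp (sumBundle a x y r) s (10 * (m + 1)) fun s' =>
      s'.narr = s.narr ∧ (∀ i < 20, s'.nreg i = s.nreg i) ∧
      (∀ i < 20, i ≠ r → s'.rreg i = s.rreg i) ∧
      s'.rreg r = bundleValue m inp (s.narr a) (s.nreg x) (s.nreg y) := by
  refine Runs.mono (B₁ := 1 + (m + 1) * (6 + 2)) (Runs.seq (Runs.op (Runs.forProg
    (Inv := fun k s' => s'.narr = s.narr ∧ (∀ i < 20, s'.nreg i = s.nreg i) ∧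
      (∀ i < 20, i ≠ r → s'.rreg i = s.rreg i) ∧
      s'.rreg r = bundleValue k inp (s.narr a) (s.nreg x) (s.nreg y))
    (by decide) (by decide) (Nat.zero_le _) hm h1 ?_ ?_))) (by omega) fun s' h => h
  · refine ⟨rfl, fun i hi => ?_, fun i hi hir => ?_, ?_⟩
    · exact Function.update_of_ne (by omega) _ _
    · exact Function.update_of_ne hir _ _
    · simp [State.setN, Op.apply, bundleValue]
  · rintro k s₁ - hk ⟨i1, i2, i3, i4⟩ hk20 hm' h1'
    refine Runs.seq (Runs.op (Runs.ite (B₁ := 3) (B₂ := 1) (fun hb => ?_) (fun hb => ?_)))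
    · refine Runs.seq (Runs.op (Runs.seq (Runs.op (Runs.op ?_))))
      simp only [Test.Holds, Op.apply, Function.update_self, i1, hk20,
        Function.update_of_ne (show y ≠ 21 by omega), i2 y hy] at hb
      simp only [Op.apply, State.setN, Function.update_self]
      refine ⟨by simp [hk20], by simp [hm'], by simp [h1'], i1, fun i hi => ?_, fun i hi hir => ?_, ?_⟩
      · rw [Function.update_of_ne (by omega), Function.update_of_ne (by omega), i2 i hi]
      · rw [Function.update_of_ne hir, Function.update_of_ne (by omega),
          Function.update_of_ne (by omega), i3 i hi hir]
      · rw [Function.update_of_ne (show r ≠ 20 by omega), Function.update_of_ne (show r ≠ 20 by omega),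
          i4, Function.update_of_ne (show x ≠ 21 by omega), i2 x hx]
        simp [bundleValue, Finset.sum_range_succ, hk20, hb]
    · refine Runs.op ?_
      simp only [Test.Holds, Op.apply, Function.update_self, i1, hk20,
        Function.update_of_ne (show y ≠ 21 by omega), i2 y hy] at hb
      simp only [Op.apply, State.setN]
      refine ⟨by simp [hk20], by simp [hm'], by simp [h1'], i1, fun i hi => ?_, i3, ?_⟩
      · rw [Function.update_of_ne (by omega), Function.update_of_ne (by omega),
          Function.update_of_ne (by omega), i2 i hi]
      · rw [i4]
        simp [bundleValue, Finset.sum_range_succ, hb]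

theorem IsReady.of_eq {n m : ℕ} {s s' : State} (h : IsReady n m s)
    (hn : ∀ i < 5, s'.nreg i = s.nreg i) (hr : s'.rreg 0 = s.rreg 0) : IsReady n m s' :=
  ⟨by rw [hn 0 (by omega), h.n_eq], by rw [hn 1 (by omega), h.m_eq],
    by rw [hn 2 (by omega), h.one_eq], by rw [hn 3 (by omega), h.zero_eq],
    by rw [hn 4 (by omega), h.succ_eq], by rw [hr, h.rzero_eq]⟩

/-- Natural array `1` becomes a copy of natural array `0`, and nothing is matched. -/
def initPhase : Prog :=
  .seq (forProg 10 0 1 (.seq (.op (.nload 11 0 10)) (.op (.nstore 1 10 11))))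
    (forProg 10 0 4 (.seq (.op (.nstore 2 10 3)) (.op (.nstore 3 10 3))))

/-- Register `5` gets an unmatched agent, or `n + 1` if there is none. -/
def findUnmatched : Prog :=
  .seq (.op (.nadd 5 4 3)) <| forProg 10 1 4 <|
    .seq (.op (.nload 11 3 10)) (.ite (.neq 11 3) (.op (.nadd 5 10 3)) skip)

/-- The agent in register `5` looks for the item whose removal leaves her the most valuable bundle
of another agent: the item is stored in register `7`, the value in real register `1`. -/
def findBest : Prog :=
  .seq (.op (.rconst 1 0)) <| forProg 10 0 1 <|
    .seq (.op (.nload 11 1 10)) <| .ite (.neq 11 3) skip <| .ite (.neq 11 5) skip <|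
      .seq (sumBundle 1 5 11 2) <| .seq (.op (.rconst 3 1)) <|
        .seq (.op (.rmulInput 3 3 5 10)) <| .seq (.op (.rsub 2 2 3)) <|
          .ite (.rlt 1 2) (.seq (.op (.radd 1 2 0)) (.op (.nadd 7 10 3))) skip

/-- The agent in register `5` chooses a bundle, whose label is stored in register `6`; from a bundle
of another agent, the item in register `7` is removed. -/
def choose : Prog :=
  .seq (sumBundle 1 5 5 2) <| .seq (.op (.rmulInput 1 1 3 3)) <|
    .ite (.rlt 2 1) (.seq (.op (.nload 6 1 7)) (.op (.nstore 1 7 3))) (.op (.nadd 6 5 3))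

/-- The agent in register `5` takes the bundle in register `6`. -/
def rematch : Prog :=
  .seq (.op (.nload 11 2 6)) <| .seq (.op (.nstore 3 11 3)) <| .seq (.op (.nstore 3 5 6)) <|
    .op (.nstore 2 6 5)

/-- Real register `3` becomes positive if the owner of the bundle in register `6` has lost too much
of it. -/
def measureLoss : Prog :=
  .seq (sumBundle 0 6 6 1) <| .seq (sumBundle 1 6 6 2) <| .seq (.op (.rmulInput 3 2 3 3)) <|
    .seq (.op (.radd 2 2 3)) <| .seq (.op (.rsub 1 1 2)) <| .seq (.op (.rmulInput 3 2 3 3)) <|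
      .seq (.op (.rsub 3 0 3)) <|
        forProg 10 0 0 <| .seq (.op (.radd 3 3 1)) (.op (.radd 3 3 1))

/-- The walk from the bundle in register `6` along the holders, recorded in natural array `4`; its
end is stored in register `9`. -/
def walk : Prog :=
  .seq (forProg 10 1 4 (.op (.nstore 4 10 10))) <| .seq (.op (.nstore 4 6 5)) <|
    .seq (.op (.nadd 9 5 3)) <| .seq (.op (.nload 8 2 9)) <| .loop (.nlt 3 8) <|
      .seq (.op (.nstore 4 9 8)) <| .seq (.op (.nadd 9 8 3)) <| .seq (.op (.nload 8 2 9)) <|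
        .ite (.neq 9 6) (.op (.nconst 8 0)) skip

/-- The bundles are shifted along the walk. -/
def shift : Prog :=
  .seq
    (forProg 10 0 1 <| .seq (.op (.nload 11 1 10)) <| .ite (.neq 11 3) skip <|
      .seq (.op (.nload 11 4 11)) (.op (.nstore 0 10 11)))
    (.ite (.neq 9 6) (.op (.nstore 0 7 3)) skip)

/-! ### Correctness and running time of the subprograms -/

section Specs

variable {inp : ℕ → ℕ → ℝ} {n m : ℕ} {s : State}

theorem runs_initPhase (h : IsReady n m s) :
    Runs inp initPhase s (4 * (n + m + 3)) fun s' => IsReady n m s' ∧ s'.narr 0 = s.narr 0 ∧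
      (∀ g < m, s'.narr 1 g = s.narr 0 g) ∧ (∀ b ≤ n, s'.narr 2 b = 0) ∧
      ∀ a ∈ Finset.Icc 1 n, s'.narr 3 a = 0 := by
  refine Runs.mono (B₁ := (m + 1) * (2 + 2) + (n + 1 + 1) * (2 + 2)) (Runs.seq ((Runs.forProg
    (Inv := fun k s' => IsReady n m s' ∧ s'.narr 0 = s.narr 0 ∧ ∀ g < k, s'.narr 1 g = s.narr 0 g)
    (by decide) (by decide) (Nat.zero_le _) h.m_eq h.one_eq ?_ ?_).mono le_rfl ?_)) (by omega)
    fun _ h => h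
  · exact ⟨by constructor <;> simp [State.setN, h.n_eq, h.m_eq, h.one_eq, h.zero_eq, h.succ_eq,
      h.rzero_eq], rfl, by simp⟩
  · rintro k s₁ - hk ⟨h, h0, h1⟩ hk10 - -
    refine Runs.seq (Runs.op (Runs.op ?_))
    simp only [Op.apply, State.setN]
    refine ⟨by simp [hk10], by simp [h.m_eq], by simp [h.one_eq], ?_, by simpa, fun g hg => ?_⟩
    · constructor <;> simp [h.n_eq, h.m_eq, h.one_eq, h.zero_eq, h.succ_eq, h.rzero_eq]
    · by_cases e : g = k
      · simp [e, hk10, h0]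
      · simpa [hk10, e] using h1 g (by omega)
  · rintro s₁ ⟨h, h0, h1⟩
    refine (Runs.forProg
      (Inv := fun k s' => IsReady n m s' ∧ s'.narr 0 = s.narr 0 ∧
        (∀ g < m, s'.narr 1 g = s.narr 0 g) ∧ (∀ b < k, s'.narr 2 b = 0) ∧
        (∀ b < k, s'.narr 3 b = 0))
      (by decide) (by decide) (Nat.zero_le _) h.succ_eq h.one_eq ?_ ?_).mono le_rfl ?_
    · exact ⟨by constructor <;> simp [State.setN, h.n_eq, h.m_eq, h.one_eq, h.zero_eq, h.succ_eq,
        h.rzero_eq], h0, h1, by simp, by simp⟩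
    · rintro k s₁ - hk ⟨h, h0, h1, h2, h3⟩ hk10 - -
      refine Runs.seq (Runs.op (Runs.op ?_))
      simp only [Op.apply, State.setN]
      refine ⟨by simp [hk10], by simp [h.succ_eq], by simp [h.one_eq], ?_, by simpa, by simpa,
        fun g hg => ?_, fun g hg => ?_⟩
      · constructor <;> simp [h.n_eq, h.m_eq, h.one_eq, h.zero_eq, h.succ_eq, h.rzero_eq]
      · by_cases e : g = k
        · simp [e, hk10, h.zero_eq]
        · simpa [hk10, e] using h2 g (by omega)
      · by_cases e : g = k
        · simp [e, hk10, h.zero_eq]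
        · simpa [hk10, e] using h3 g (by omega)
    · rintro s' ⟨h, h0, h1, h2, h3⟩
      exact ⟨h, h0, h1, fun b hb => h2 b (by omega), fun a ha => h3 a (by
        simp only [Finset.mem_Icc] at ha
        omega)⟩

theorem runs_findUnmatched (h : IsReady n m s) :
    Runs inp findUnmatched s (10 * (n + 2)) fun s' => IsReady n m s' ∧ s'.narr = s.narr ∧
      ((s'.nreg 5 = n + 1 ∧ ∀ a ∈ Finset.Icc 1 n, s.narr 3 a ≠ 0) ∨
        (s'.nreg 5 ∈ Finset.Icc 1 n ∧ s.narr 3 (s'.nreg 5) = 0)) := by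
  refine Runs.mono (B₁ := 1 + (n + 1 + 1) * (1 + (1 + 1 + 1) + 2)) (Runs.seq (Runs.op (Runs.forProg
    (Inv := fun k s' => IsReady n m s' ∧ s'.narr = s.narr ∧
      ((s'.nreg 5 = n + 1 ∧ ∀ a ∈ Finset.Ico 1 k, s.narr 3 a ≠ 0) ∨
        (s'.nreg 5 ∈ Finset.Icc 1 n ∧ s.narr 3 (s'.nreg 5) = 0)))
    (by decide) (by decide) (by omega) h.succ_eq h.one_eq ?_ ?_))) (by omega) fun _ h => h
  · refine ⟨by constructor <;> simp [Op.apply, State.setN, h.n_eq, h.m_eq, h.one_eq, h.zero_eq,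
      h.succ_eq, h.rzero_eq], rfl, Or.inl ?_⟩
    simp [Op.apply, State.setN, h.zero_eq, h.succ_eq]
  · rintro k s₁ hk1 hk ⟨h, h0, h1⟩ hk10 - -
    refine Runs.seq (Runs.op (Runs.ite (fun hb => Runs.op ?_) (fun hb => Runs.op ?_)))
    · have hb : s.narr 3 k = 0 := by simpa [Test.Holds, Op.apply, hk10, h.zero_eq, h0] using hb
      simp only [Op.apply, State.setN]
      refine ⟨by simp [hk10], by simp [h.succ_eq], by simp [h.one_eq], ?_, h0, Or.inr ?_⟩
      · constructor <;> simp [h.n_eq, h.m_eq, h.one_eq, h.zero_eq, h.succ_eq, h.rzero_eq]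
      · have : k ≤ n := by omega
        simp [hk10, h.zero_eq, hb, hk1, this]
    · have hb : s.narr 3 k ≠ 0 := by simpa [Test.Holds, Op.apply, hk10, h.zero_eq, h0] using hb
      simp only [Op.apply, State.setN]
      refine ⟨by simp [hk10], by simp [h.succ_eq], by simp [h.one_eq], ?_, h0, ?_⟩
      · constructor <;> simp [h.n_eq, h.m_eq, h.one_eq, h.zero_eq, h.succ_eq, h.rzero_eq]
      · rcases h1 with h1 | h1
        · left
          refine ⟨by simpa using h1.1, fun a ha => ?_⟩
          simp only [Finset.mem_Ico] at ha
          by_cases e : a = k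
          · rwa [e]
          · exact h1.2 a (Finset.mem_Ico.2 (by omega))
        · right
          simpa using h1

/-- The maximum starts at `0`, without an item. If it stays there, the agent will take her own
bundle, so register `7` is then irrelevant. -/
theorem runs_findBest (h : IsReady n m s) :
    Runs inp findBest s (40 * (m + 1) * (m + 1)) fun s' => IsReady n m s' ∧ s'.narr = s.narr ∧
      s'.nreg 5 = s.nreg 5 ∧
      (∀ g < m, s.narr 1 g ≠ 0 → s.narr 1 g ≠ s.nreg 5 →
        bundleValue m inp (s.narr 1) (s.nreg 5) (s.narr 1 g) - inp (s.nreg 5) g ≤ s'.rreg 1) ∧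
      (s'.rreg 1 = 0 ∨ (s'.nreg 7 < m ∧ s.narr 1 (s'.nreg 7) ≠ 0 ∧
        s.narr 1 (s'.nreg 7) ≠ s.nreg 5 ∧
        s'.rreg 1 = bundleValue m inp (s.narr 1) (s.nreg 5) (s.narr 1 (s'.nreg 7)) -
          inp (s.nreg 5) (s'.nreg 7))) := by
  refine Runs.mono
    (B₁ := 1 + (m + 1) * (1 + (1 + (1 + (10 * (m + 1) + (1 + (1 + (1 + (2 + 1 + 1))))) + 1) + 1) + 2))
    (Runs.seq (Runs.op (Runs.forProg
    (Inv := fun k s' => IsReady n m s' ∧ s'.narr = s.narr ∧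
      s'.nreg 5 = s.nreg 5 ∧
      (∀ g < k, s.narr 1 g ≠ 0 → s.narr 1 g ≠ s.nreg 5 →
        bundleValue m inp (s.narr 1) (s.nreg 5) (s.narr 1 g) - inp (s.nreg 5) g ≤ s'.rreg 1) ∧
      (s'.rreg 1 = 0 ∨ (s'.nreg 7 < m ∧ s.narr 1 (s'.nreg 7) ≠ 0 ∧
        s.narr 1 (s'.nreg 7) ≠ s.nreg 5 ∧
        s'.rreg 1 = bundleValue m inp (s.narr 1) (s.nreg 5) (s.narr 1 (s'.nreg 7)) -
          inp (s.nreg 5) (s'.nreg 7))))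
    (by decide) (by decide) (Nat.zero_le _) h.m_eq h.one_eq ?_ ?_))) (by nlinarith) fun _ h => h
  · refine ⟨by constructor <;> simp [Op.apply, State.setN, h.n_eq, h.m_eq, h.one_eq, h.zero_eq,
      h.succ_eq, h.rzero_eq], rfl, rfl, by simp, Or.inl ?_⟩
    simp [Op.apply, State.setN]
  · rintro k s₁ - hk ⟨h, h0, h5, hmax, hbest⟩ hk10 - -
    have hskip : ∀ s₂ : State, s₂.narr = s₁.narr → (∀ i < 20, i ≠ 11 → s₂.nreg i = s₁.nreg i) →
        (∀ i < 2, s₂.rreg i = s₁.rreg i) →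
        (s.narr 1 k ≠ 0 → s.narr 1 k ≠ s.nreg 5 →
          bundleValue m inp (s.narr 1) (s.nreg 5) (s.narr 1 k) - inp (s.nreg 5) k ≤ s₁.rreg 1) →
        Runs inp skip s₂ 1 fun s' => s'.nreg 10 = k ∧ s'.nreg 1 = m ∧ s'.nreg 2 = 1 ∧
          IsReady n m (s'.setN 10 (k + 1)) ∧ (s'.setN 10 (k + 1)).narr = s.narr ∧
          (s'.setN 10 (k + 1)).nreg 5 = s.nreg 5 ∧
          (∀ g < k + 1, s.narr 1 g ≠ 0 → s.narr 1 g ≠ s.nreg 5 →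
            bundleValue m inp (s.narr 1) (s.nreg 5) (s.narr 1 g) - inp (s.nreg 5) g ≤
              (s'.setN 10 (k + 1)).rreg 1) ∧
          ((s'.setN 10 (k + 1)).rreg 1 = 0 ∨ ((s'.setN 10 (k + 1)).nreg 7 < m ∧
            s.narr 1 ((s'.setN 10 (k + 1)).nreg 7) ≠ 0 ∧
            s.narr 1 ((s'.setN 10 (k + 1)).nreg 7) ≠ s.nreg 5 ∧
            (s'.setN 10 (k + 1)).rreg 1 = bundleValue m inp (s.narr 1) (s.nreg 5)
              (s.narr 1 ((s'.setN 10 (k + 1)).nreg 7)) -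
                inp (s.nreg 5) ((s'.setN 10 (k + 1)).nreg 7))) := by
      intro s₂ e1 e2 e3 e4
      refine Runs.op ?_
      have er := e3 1 (by omega)
      simp only [Op.apply, State.setN]
      refine ⟨by simp [e2, hk10], by simp [e2, h.m_eq], by simp [e2, h.one_eq], ?_, e1.trans h0,
        by simp [e2, h5], fun g hg hg1 hg2 => ?_, ?_⟩
      · constructor <;>
          simp [e2, e3, h.n_eq, h.m_eq, h.one_eq, h.zero_eq, h.succ_eq, h.rzero_eq]
      · rw [er]
        by_cases e : g = k
        · rw [e] at hg1 hg2 ⊢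
          exact e4 hg1 hg2
        · exact hmax g (by omega) hg1 hg2
      · rw [er]
        simpa [e2] using hbest
    refine Runs.seq (Runs.op (Runs.ite (fun hb => ?_) (fun hb => ?_)))
    · have hb : s.narr 1 k = 0 := by simpa [Test.Holds, Op.apply, hk10, h.zero_eq, h0] using hb
      refine hskip _ rfl (fun i _ hi => ?_) (fun i _ => rfl) (fun h => absurd hb h)
      simp [Op.apply, hi]
    refine Runs.ite (fun hb' => ?_) (fun hb' => ?_)
    · have hb' : s.narr 1 k = s.nreg 5 := by simpa [Test.Holds, Op.apply, hk10, h5, h0] using hb'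
      refine hskip _ rfl (fun i _ hi => ?_) (fun i _ => rfl) (fun _ h => absurd hb' h)
      simp [Op.apply, hi]
    have hb : s.narr 1 k ≠ 0 := by simpa [Test.Holds, Op.apply, hk10, h.zero_eq, h0] using hb
    have hb' : s.narr 1 k ≠ s.nreg 5 := by simpa [Test.Holds, Op.apply, hk10, h5, h0] using hb'
    refine Runs.seq ((runs_sumBundle (by simp [Op.apply, h.m_eq]) (by simp [Op.apply, h.one_eq])
      (by decide) (by decide) (by decide)).mono le_rfl ?_)
    rintro s₂ ⟨e1, e2, e3, e4⟩
    have e2' : ∀ i < 20, i ≠ 11 → s₂.nreg i = s₁.nreg i := fun i hi hi' => by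
      rw [e2 i hi]
      simp [Op.apply, hi']
    have e3' : ∀ i < 20, i ≠ 2 → s₂.rreg i = s₁.rreg i := fun i hi hi' => by
      rw [e3 i hi hi']
      rfl
    have e5 : s₂.rreg 2 = bundleValue m inp (s.narr 1) (s.nreg 5) (s.narr 1 k) := by
      rw [e4]
      simp [Op.apply, h0, h5, hk10]
    refine Runs.seq (Runs.op (Runs.seq (Runs.op (Runs.seq (Runs.op
      (Runs.ite (fun hlt => ?_) (fun hlt => ?_)))))))
    · have hlt : s₁.rreg 1 < bundleValue m inp (s.narr 1) (s.nreg 5) (s.narr 1 k) -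
          inp (s.nreg 5) k := by
        simpa [Test.Holds, Op.apply, e2', e3', e5, h5, hk10] using hlt
      refine Runs.seq (Runs.op (Runs.op ?_))
      simp only [Op.apply, State.setN]
      refine ⟨by simp [e2', hk10], by simp [e2', h.m_eq], by simp [e2', h.one_eq], ?_, ?_,
        by simp [e2', h5], fun g hg hg1 hg2 => ?_, Or.inr ?_⟩
      · constructor <;>
          simp [e2', e3', h.n_eq, h.m_eq, h.one_eq, h.zero_eq, h.succ_eq, h.rzero_eq]
      · rw [e1]
        exact h0
      · suffices hs : bundleValue m inp (s.narr 1) (s.nreg 5) (s.narr 1 g) - inp (s.nreg 5) g ≤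
            bundleValue m inp (s.narr 1) (s.nreg 5) (s.narr 1 k) - inp (s.nreg 5) k by
          simpa [e2', e3', e5, hk10, h5, h.rzero_eq] using hs
        by_cases e : g = k
        · rw [e]
        · exact (hmax g (by omega) hg1 hg2).trans hlt.le
      · simp [e2', e3', e5, hk10, h5, h.zero_eq, h.rzero_eq, hk, hb, hb']
    · have hlt : ¬ s₁.rreg 1 < bundleValue m inp (s.narr 1) (s.nreg 5) (s.narr 1 k) -
          inp (s.nreg 5) k := by
        simpa [Test.Holds, Op.apply, e2', e3', e5, h5, hk10] using hlt
      refine (hskip _ ?_ ?_ ?_ ?_).mono (by omega) fun _ h => h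
      · exact e1
      · exact e2'
      · intro i hi
        have h2 : i ≠ 2 := by omega
        have h3 : i ≠ 3 := by omega
        simp [Op.apply, h2, h3, e3' i (by omega) h2]
      · exact fun _ _ => not_lt.1 hlt

end Specs

section Specs

variable {inp : ℕ → ℕ → ℝ} {n m : ℕ} {s : State}

theorem runs_choose (h : IsReady n m s) :
    Runs inp choose s (10 * (m + 1) + 5) fun s' => IsReady n m s' ∧ s'.narr 0 = s.narr 0 ∧
      s'.narr 2 = s.narr 2 ∧ s'.narr 3 = s.narr 3 ∧ s'.nreg 5 = s.nreg 5 ∧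
      s'.nreg 7 = s.nreg 7 ∧
      ((bundleValue m inp (s.narr 1) (s.nreg 5) (s.nreg 5) < inp 0 0 * s.rreg 1 ∧
          s'.nreg 6 = s.narr 1 (s.nreg 7) ∧
          s'.narr 1 = Function.update (s.narr 1) (s.nreg 7) 0) ∨
        (¬ bundleValue m inp (s.narr 1) (s.nreg 5) (s.nreg 5) < inp 0 0 * s.rreg 1 ∧
          s'.nreg 6 = s.nreg 5 ∧ s'.narr 1 = s.narr 1)) := by
  refine Runs.mono (B₁ := 10 * (m + 1) + (1 + (2 + 1 + 1))) (Runs.seq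
    ((runs_sumBundle h.m_eq h.one_eq (by decide) (by decide) (by decide)).mono le_rfl ?_))
    (by omega) fun _ h => h
  rintro s₁ ⟨e1, e2, e3, e4⟩
  refine Runs.seq (Runs.op (Runs.ite (fun hb => Runs.seq (Runs.op (Runs.op ?_)))
    (fun hb => Runs.op ?_)))
  · have hb : bundleValue m inp (s.narr 1) (s.nreg 5) (s.nreg 5) < inp 0 0 * s.rreg 1 := by
      rw [mul_comm]
      simpa [Test.Holds, Op.apply, e1, e2, e3, e4, h.zero_eq] using hb
    simp only [Op.apply]
    refine ⟨?_, by simp [e1], by simp [e1], by simp [e1], by simp [e2], by simp [e2],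
      Or.inl ⟨hb, by simp [e1, e2], by simp [e1, e2, h.zero_eq]⟩⟩
    constructor <;> simp [e2, e3, h.n_eq, h.m_eq, h.one_eq, h.zero_eq, h.succ_eq, h.rzero_eq]
  · have hb : ¬ bundleValue m inp (s.narr 1) (s.nreg 5) (s.nreg 5) < inp 0 0 * s.rreg 1 := by
      rw [mul_comm]
      simpa [Test.Holds, Op.apply, e1, e2, e3, e4, h.zero_eq] using hb
    simp only [Op.apply]
    refine ⟨?_, by simp [e1], by simp [e1], by simp [e1], by simp [e2], by simp [e2],
      Or.inr ⟨hb, by simp [e2, h.zero_eq], by simp [e1]⟩⟩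
    constructor <;> simp [e2, e3, h.n_eq, h.m_eq, h.one_eq, h.zero_eq, h.succ_eq, h.rzero_eq]

/-- If the bundle was unheld, the displaced agent is the dummy `0`; overwriting entry `0` of `mate`
is harmless, since a matching constrains `mate` only on `1, …, n`. -/
theorem runs_rematch (h : IsReady n m s) :
    Runs inp rematch s 4 fun s' => IsReady n m s' ∧ s'.narr 0 = s.narr 0 ∧
      s'.narr 1 = s.narr 1 ∧ s'.nreg 5 = s.nreg 5 ∧ s'.nreg 6 = s.nreg 6 ∧ s'.nreg 7 = s.nreg 7 ∧
      s'.narr 2 = Function.update (s.narr 2) (s.nreg 6) (s.nreg 5) ∧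
      s'.narr 3 = Function.update (Function.update (s.narr 3) (s.narr 2 (s.nreg 6)) 0)
        (s.nreg 5) (s.nreg 6) := by
  refine Runs.seq (Runs.op (Runs.seq (Runs.op (Runs.seq (Runs.op (Runs.op ?_))))))
  simp only [Op.apply]
  refine ⟨?_, by simp, by simp, by simp, by simp, by simp, by simp, by simp [h.zero_eq]⟩
  constructor <;> simp [h.n_eq, h.m_eq, h.one_eq, h.zero_eq, h.succ_eq, h.rzero_eq]

/-- The threshold of `IsLarge` is rearranged to the sign of `2n(V - (1 + α)Z) - α(1 + α)Z`. The
factor `2n` comes from repeated addition, because α is an input to multiply by and `n` is not. -/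
theorem runs_measureLoss (h : IsReady n m s) :
    Runs inp measureLoss s (20 * (n + m + 2)) fun s' => IsReady n m s' ∧ s'.narr = s.narr ∧
      s'.nreg 5 = s.nreg 5 ∧ s'.nreg 6 = s.nreg 6 ∧ s'.nreg 7 = s.nreg 7 ∧
      (0 < s'.rreg 3 ↔ ¬ IsLarge n m inp (inp 0 0) (s.narr 0) (s.narr 1) (s.nreg 6)) := by
  refine Runs.mono
    (B₁ := 10 * (m + 1) + (10 * (m + 1) + (1 + (1 + (1 + (1 + (1 + (n + 1) * (2 + 2))))))))
    (Runs.seq ((runs_sumBundle h.m_eq h.one_eq (by decide) (by decide) (by decide)).mono le_rfl ?_))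
    (by omega) fun _ h => h
  rintro s₁ ⟨a1, a2, a3, a4⟩
  refine Runs.seq ((runs_sumBundle (m := m) (by rw [a2 1 (by decide), h.m_eq])
    (by rw [a2 2 (by decide), h.one_eq]) (by decide) (by decide) (by decide)).mono le_rfl ?_)
  rintro s₂ ⟨b1, b2, b3, b4⟩
  refine Runs.seq (Runs.op (Runs.seq (Runs.op (Runs.seq (Runs.op (Runs.seq (Runs.op (Runs.seq
    (Runs.op ?_)))))))))
  set V := bundleValue m inp (s.narr 0) (s.nreg 6) (s.nreg 6)
  set Z := bundleValue m inp (s.narr 1) (s.nreg 6) (s.nreg 6)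
  have hV : s₂.rreg 1 = V := by rw [b3 1 (by decide) (by decide), a4]
  have hZ : s₂.rreg 2 = Z := by rw [b4, a1, a2 6 (by decide)]
  have hn : ∀ i < 20, s₂.nreg i = s.nreg i := fun i hi => (b2 i hi).trans (a2 i hi)
  have h0 : s₂.rreg 0 = 0 := by
    rw [b3 0 (by decide) (by decide), a3 0 (by decide) (by decide), h.rzero_eq]
  refine (Runs.forProg (K := n)
    (Inv := fun k s' => IsReady n m s' ∧ s'.narr = s.narr ∧
      s'.nreg 5 = s.nreg 5 ∧ s'.nreg 6 = s.nreg 6 ∧ s'.nreg 7 = s.nreg 7 ∧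
      s'.rreg 1 = V - (1 + inp 0 0) * Z ∧
      s'.rreg 3 = 2 * k * (V - (1 + inp 0 0) * Z) - inp 0 0 * ((1 + inp 0 0) * Z))
    (by decide) (by decide) (Nat.zero_le _) ?_ ?_ ?_ ?_).mono le_rfl ?_
  · simp [Op.apply, hn, h.n_eq]
  · simp [Op.apply, hn, h.one_eq]
  · simp only [Op.apply, State.setN]
    refine ⟨?_, b1.trans a1, by simp [hn], by simp [hn], by simp [hn], ?_, ?_⟩
    · constructor <;>
        simp [hn, h0, h.n_eq, h.m_eq, h.one_eq, h.zero_eq, h.succ_eq]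
    · simp [hn, hV, hZ, h.zero_eq]
      ring
    · simp [hn, hZ, h.zero_eq, h0]
      ring
  · rintro k s₁ - hk ⟨h, i1, i2, i3, i4, i5, i6⟩ hk10 - -
    refine Runs.seq (Runs.op (Runs.op ?_))
    simp only [Op.apply, State.setN]
    refine ⟨by simp [hk10], by simp [h.n_eq], by simp [h.one_eq], ?_, i1, by simp [i2],
      by simp [i3], by simp [i4], by simp [i5], ?_⟩
    · constructor <;> simp [h.n_eq, h.m_eq, h.one_eq, h.zero_eq, h.succ_eq, h.rzero_eq]
    · simp [i5, i6]
      ring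
  · rintro s' ⟨h, i1, i2, i3, i4, -, i6⟩
    refine ⟨h, i1, i2, i3, i4, ?_⟩
    rw [i6, IsLarge, not_le]
    constructor <;> intro <;> linarith

/-- Register `8` holds the next agent. It is forced to `0` when the walk returns to its start, so a
single test detects both an unheld bundle and a closed cycle. -/
theorem runs_walk {mate : ℕ → ℕ} (h : IsReady n m s) (hM : IsMatching n (s.narr 2) mate)
    (hb : s.nreg 6 ∈ Finset.Icc 1 n) (hc : s.nreg 5 ≠ 0) (hne : s.nreg 5 ≠ s.nreg 6)
    (hbc : s.narr 2 (s.nreg 6) = s.nreg 5) :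
    Runs inp walk s (20 * (n + 1)) fun s' => IsReady n m s' ∧ s'.narr 0 = s.narr 0 ∧
      s'.narr 1 = s.narr 1 ∧ s'.nreg 6 = s.nreg 6 ∧ s'.nreg 7 = s.nreg 7 ∧
      IsWalk n (s.narr 2) (s.nreg 6) (s'.narr 4) (s'.nreg 9) ∧
      (s'.nreg 9 = s.nreg 6 ∨ s.narr 2 (s'.nreg 9) = 0) := by
  refine Runs.mono (B₁ := (n + 1 + 1) * (1 + 2) + (1 + (1 + (1 + (n * (6 + 1) + 1)))))
    (Runs.seq ((Runs.forProg (K := n + 1)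
    (Inv := fun k s' => IsReady n m s' ∧ s'.narr 0 = s.narr 0 ∧ s'.narr 1 = s.narr 1 ∧
      s'.narr 2 = s.narr 2 ∧ s'.nreg 5 = s.nreg 5 ∧ s'.nreg 6 = s.nreg 6 ∧
      s'.nreg 7 = s.nreg 7 ∧ ∀ y ∈ Finset.Ico 1 k, s'.narr 4 y = y)
    (by decide) (by decide) (by omega) h.succ_eq h.one_eq ?_ ?_).mono le_rfl ?_))
    (by omega) fun _ h => h
  · refine ⟨?_, rfl, rfl, rfl, rfl, rfl, rfl, by simp⟩
    constructor <;> simp [State.setN, h.n_eq, h.m_eq, h.one_eq, h.zero_eq, h.succ_eq, h.rzero_eq]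
  · rintro k s₁ - hk ⟨h, i0, i1, i2, i5, i6, i7, i4⟩ hk10 - -
    refine Runs.op ?_
    simp only [Op.apply, State.setN]
    refine ⟨by simp [hk10], by simp [h.succ_eq], by simp [h.one_eq], ?_, by simp [i0],
      by simp [i1], by simp [i2], by simp [i5], by simp [i6], by simp [i7], fun y hy => ?_⟩
    · constructor <;> simp [h.n_eq, h.m_eq, h.one_eq, h.zero_eq, h.succ_eq, h.rzero_eq]
    · by_cases e : y = k
      · simp [e, hk10]
      · simp only [Finset.mem_Ico] at hy
        simpa [e, hk10] using i4 y (Finset.mem_Ico.2 (by omega))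
  · rintro s₁ ⟨h, i0, i1, i2, i5, i6, i7, i4⟩
    refine Runs.seq (Runs.op (Runs.seq (Runs.op (Runs.seq (Runs.op ?_)))))
    have hstart : IsWalk n (s.narr 2) (s.nreg 6)
        (Function.update (s₁.narr 4) (s.nreg 6) (s.nreg 5)) (s.nreg 5) := by
      have := IsWalk.init (nw := s₁.narr 4) hM hb (hbc ▸ hc) (hbc ▸ hne)
        fun y hy => i4 y (Finset.mem_Ico.2 (by simp only [Finset.mem_Icc] at hy; omega))
      rwa [hbc] at this
    refine (Runs.loop
      (Inv := fun μ s' => IsReady n m s' ∧ s'.narr 0 = s.narr 0 ∧ s'.narr 1 = s.narr 1 ∧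
        s'.narr 2 = s.narr 2 ∧ s'.nreg 6 = s.nreg 6 ∧ s'.nreg 7 = s.nreg 7 ∧
        IsWalk n (s.narr 2) (s.nreg 6) (s'.narr 4) (s'.nreg 9) ∧
        s'.nreg 8 = (if s'.nreg 9 = s.nreg 6 then 0 else s.narr 2 (s'.nreg 9)) ∧
        μ = ((Finset.Icc 1 n).filter fun y => s'.narr 4 y = y).card) (B := 6) ?_ _ _
      ⟨?_, ?_, ?_, ?_, ?_, ?_, ?_, ?_, rfl⟩).mono ?_ ?_
    · rintro μ s₂ ⟨h, i0, i1, i2, i6, i7, hw, i8, rfl⟩ ht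
      have ht : 0 < s₂.nreg 8 := by simpa [Test.Holds, h.zero_eq] using ht
      have hjb : s₂.nreg 9 ≠ s.nreg 6 := by
        intro e
        rw [i8, if_pos e] at ht
        exact absurd ht (lt_irrefl 0)
      rw [if_neg hjb] at i8
      have hstep := hw.step hM hjb (by omega)
      have hcard := hw.card_fixed_lt hM hjb (by omega)
      rw [← i8] at hstep hcard
      refine Runs.seq (Runs.op (Runs.seq (Runs.op (Runs.seq (Runs.op
        (Runs.ite (fun hb => Runs.op ?_) (fun hb => Runs.op ?_)))))))
      · have hb : s₂.nreg 8 = s.nreg 6 := by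
          simpa [Test.Holds, Op.apply, h.zero_eq, i6] using hb
        simp only [Op.apply]
        refine ⟨_, hcard, ?_, by simp [i0], by simp [i1], by simp [i2], by simp [i6], by simp [i7],
          ?_, ?_, ?_⟩
        · constructor <;> simp [h.n_eq, h.m_eq, h.one_eq, h.zero_eq, h.succ_eq, h.rzero_eq]
        · simpa [h.zero_eq] using hstep
        · simp [h.zero_eq, hb]
        · simp
      · have hb : s₂.nreg 8 ≠ s.nreg 6 := by
          simpa [Test.Holds, Op.apply, h.zero_eq, i6] using hb
        simp only [Op.apply]
        refine ⟨_, hcard, ?_, by simp [i0], by simp [i1], by simp [i2], by simp [i6], by simp [i7],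
          ?_, ?_, ?_⟩
        · constructor <;> simp [h.n_eq, h.m_eq, h.one_eq, h.zero_eq, h.succ_eq, h.rzero_eq]
        · simpa [h.zero_eq] using hstep
        · simp [h.zero_eq, hb, i2]
        · simp
    · constructor <;>
        simp [Op.apply, h.n_eq, h.m_eq, h.one_eq, h.zero_eq, h.succ_eq, h.rzero_eq]
    · simp [Op.apply, i0]
    · simp [Op.apply, i1]
    · simp [Op.apply, i2]
    · simp [Op.apply, i6]
    · simp [Op.apply, i7]
    · simpa [Op.apply, h.zero_eq, i5, i6] using hstart
    · simp [Op.apply, h.zero_eq, i5, hne, i2]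
    · have : ∀ p : ℕ → Prop, [DecidablePred p] → ((Finset.Icc 1 n).filter p).card ≤ n := by
        intro p _
        exact (Finset.card_filter_le _ _).trans (by simp)
      exact Nat.add_le_add_right (Nat.mul_le_mul_right _ (this _)) _
    · rintro s' ⟨ht, μ, h, i0, i1, i2, i6, i7, hw, i8, -⟩
      refine ⟨h, i0, i1, i6, i7, hw, ?_⟩
      have ht : s'.nreg 8 = 0 := by simpa [Test.Holds, h.zero_eq] using ht
      by_cases e : s'.nreg 9 = s.nreg 6
      · exact Or.inl e
      · rw [if_neg e] at i8
        right
        omega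

/-- Overwriting the owners in place is safe: a new owner is computed from arrays `1` and `4` alone.
-/
theorem runs_shift (h : IsReady n m s) :
    Runs inp shift s (10 * (m + 2)) fun s' => IsReady n m s' ∧
      ∀ g < m, s'.narr 0 g = if g = s.nreg 7 ∧ s.nreg 9 = s.nreg 6 then 0 else
        if s.narr 1 g = 0 then s.narr 0 g else s.narr 4 (s.narr 1 g) := by
  refine Runs.mono (B₁ := (m + 1) * (1 + (1 + (1 + 1) + 1) + 2) + (1 + 1 + 1))
    (Runs.seq ((Runs.forProg (K := m)
    (Inv := fun k s' => IsReady n m s' ∧ s'.narr 1 = s.narr 1 ∧ s'.narr 4 = s.narr 4 ∧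
      s'.nreg 6 = s.nreg 6 ∧ s'.nreg 7 = s.nreg 7 ∧ s'.nreg 9 = s.nreg 9 ∧
      ∀ g, s'.narr 0 g = if g < k ∧ s.narr 1 g ≠ 0 then s.narr 4 (s.narr 1 g) else s.narr 0 g)
    (by decide) (by decide) (Nat.zero_le _) h.m_eq h.one_eq ?_ ?_).mono le_rfl ?_))
    (by omega) fun _ h => h
  · refine ⟨?_, rfl, rfl, rfl, rfl, rfl, by simp [State.setN]⟩
    constructor <;> simp [State.setN, h.n_eq, h.m_eq, h.one_eq, h.zero_eq, h.succ_eq, h.rzero_eq]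
  · rintro k s₁ - hk ⟨h, i1, i4, i6, i7, i9, i0⟩ hk10 - -
    refine Runs.seq (Runs.op (Runs.ite (fun hb => Runs.op ?_)
      (fun hb => Runs.seq (Runs.op (Runs.op ?_)))))
    · have hb : s.narr 1 k = 0 := by simpa [Test.Holds, Op.apply, hk10, i1, h.zero_eq] using hb
      simp only [Op.apply, State.setN]
      refine ⟨by simp [hk10], by simp [h.m_eq], by simp [h.one_eq], ?_, i1, i4, by simp [i6],
        by simp [i7], by simp [i9], fun g => ?_⟩
      · constructor <;> simp [h.n_eq, h.m_eq, h.one_eq, h.zero_eq, h.succ_eq, h.rzero_eq]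
      · rw [i0]
        by_cases e : g = k
        · simp [e, hb]
        · have : g < k + 1 ↔ g < k := by omega
          simp only [this]
    · have hb : s.narr 1 k ≠ 0 := by simpa [Test.Holds, Op.apply, hk10, i1, h.zero_eq] using hb
      simp only [Op.apply, State.setN]
      refine ⟨by simp [hk10], by simp [h.m_eq], by simp [h.one_eq], ?_, by simp [i1], by simp [i4],
        by simp [i6], by simp [i7], by simp [i9], fun g => ?_⟩
      · constructor <;> simp [h.n_eq, h.m_eq, h.one_eq, h.zero_eq, h.succ_eq, h.rzero_eq]
      · by_cases e : g = k
        · simp [e, hb, hk10, i1, i4]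
        · have : g < k + 1 ↔ g < k := by omega
          simp only [this]
          rw [← i0]
          simp [hk10, e]
  · rintro s₁ ⟨h, i1, i4, i6, i7, i9, i0⟩
    refine Runs.ite (fun hb => Runs.op ?_) (fun hb => Runs.op ?_)
    · have hb : s.nreg 9 = s.nreg 6 := by simpa [Test.Holds, i6, i9] using hb
      simp only [Op.apply]
      refine ⟨?_, fun g hg => ?_⟩
      · constructor <;> simp [h.n_eq, h.m_eq, h.one_eq, h.zero_eq, h.succ_eq, h.rzero_eq]
      · by_cases e : g = s.nreg 7
        · simp [e, i7, hb, h.zero_eq]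
        · simp [e, i7, i0, hg]
    · have hb : ¬ s.nreg 9 = s.nreg 6 := by simpa [Test.Holds, i6, i9] using hb
      simp only [Op.apply]
      refine ⟨?_, fun g hg => ?_⟩
      · constructor <;> simp [h.n_eq, h.m_eq, h.one_eq, h.zero_eq, h.succ_eq, h.rzero_eq]
      · simp [hb, i0, hg]

end Specs

/-! ### Termination of the main loop -/

/-- The number of iterations of the main loop that are still possible, if the welfare can grow by a
factor `1 + 1 / (3 * n)` at most `R` times. -/
def loopMeasure (n m R : ℕ) (x z mate : ℕ → ℕ) : ℕ :=
  (R + numAllocated m x) * ((n + 1) * m + n + 1) +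
    ((n + 1) * numAllocated m z + ((Finset.Icc 1 n).filter fun a => mate a ≠ a).card)

/-- The invariant of the main loop. -/
structure IsLoopState (n m : ℕ) (w : ℕ → ℕ → ℝ) (α W₀ W₁ : ℝ) (μ : ℕ) (x z hold mate : ℕ → ℕ) :
    Prop where
  phase : IsPhase n m w α x z hold mate
  large : ∀ a ∈ Finset.Icc 1 n, IsLarge n m w α x z a
  pos : AllPositive n m w x
  welfare_ge : W₀ ≤ welfare n m w x
  fuel : ∃ R : ℕ, W₁ ≤ welfare n m w x * (1 + 1 / (3 * (n : ℝ))) ^ R ∧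
    μ = loopMeasure n m R x z mate

theorem numAllocated_le (m : ℕ) (x : ℕ → ℕ) : numAllocated m x ≤ m :=
  (Finset.card_filter_le _ _).trans (by simp)

theorem card_unsettled_le (n : ℕ) (mate : ℕ → ℕ) :
    ((Finset.Icc 1 n).filter fun a => mate a ≠ a).card ≤ n :=
  (Finset.card_filter_le _ _).trans (by simp)

/-- The weight `(n + 1) * m + n + 1` exceeds every value of the summand for a single phase, so a new
phase may start with an arbitrary such value. -/
theorem loopMeasure_init_lt {n m R R' : ℕ} {x x' z z' mate mate' : ℕ → ℕ}
    (h : R' + numAllocated m x' < R + numAllocated m x) :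
    loopMeasure n m R' x' z' mate' < loopMeasure n m R x z mate := by
  have h1 := card_unsettled_le n mate'
  have h2 : (n + 1) * numAllocated m z' ≤ (n + 1) * m :=
    Nat.mul_le_mul_left _ (numAllocated_le m z')
  have h3 : (R' + numAllocated m x' + 1) * ((n + 1) * m + n + 1) ≤
      (R + numAllocated m x) * ((n + 1) * m + n + 1) := Nat.mul_le_mul_right _ h
  rw [Nat.succ_mul] at h3
  unfold loopMeasure
  omega

section Step

variable {n m μ : ℕ} {w : ℕ → ℕ → ℝ} {α W₀ W₁ : ℝ} {x x' z z' hold hold' mate mate' nw : ℕ → ℕ}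
  {c g₀ j : ℕ}

/-- Agent `c` becomes settled with her own bundle. Whoever is displaced held the bundle of `c` and
was not settled, so the number of unsettled agents drops. -/
theorem IsLoopState.take_own (hw : ∀ a g, 0 ≤ w a g) (hα : 0 ≤ α) (hα1 : α ≤ 1)
    (h : IsLoopState n m w α W₀ W₁ μ x z hold mate) (hc : c ∈ Finset.Icc 1 n) (hc0 : mate c = 0)
    (hown : ∀ g < m, z g ≠ 0 → z g ≠ c →
      α * (bundleValue m w z c (z g) - w c g) ≤ bundleValue m w z c c) :
    ∃ μ' < μ, IsLoopState n m w α W₀ W₁ μ' x z (Function.update hold c c)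
      (Function.update (Function.update mate (hold c) 0) c c) := by
  obtain ⟨R, hR, rfl⟩ := h.fuel
  have hc1 := (Finset.mem_Icc.1 hc).1
  refine ⟨_, ?_, h.phase.take_own hw hα hα1 hc hc0 hown, h.large, h.pos, h.welfare_ge, R, hR, rfl⟩
  unfold loopMeasure
  refine Nat.add_lt_add_left (Nat.add_lt_add_left (Finset.card_lt_card
    (Finset.ssubset_iff_of_subset ?_ |>.2 ⟨c, ?_, ?_⟩)) _) _
  · intro a ha
    simp only [Finset.mem_filter] at ha ⊢
    refine ⟨ha.1, fun e => ?_⟩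
    by_cases e1 : a = c
    · subst e1
      omega
    · have ha2 := ha.2
      rw [Function.update_of_ne e1] at ha2
      by_cases e2 : a = hold c
      · have := (h.phase.matching.mate_iff a ha.1 c hc).2 e2.symm
        omega
      · rw [Function.update_of_ne e2] at ha2
        exact ha2 e
  · refine Finset.mem_filter.2 ⟨hc, ?_⟩
    omega
  · simp

/-- Up to `n` agents may be unsettled afterwards, which the weight `n + 1` of the removed item
outweighs. -/
theorem IsLoopState.take_other (hw : ∀ a g, 0 ≤ w a g) (hα : 0 ≤ α) (hα1 : α ≤ 1)
    (h : IsLoopState n m w α W₀ W₁ μ x z hold mate) (hc : c ∈ Finset.Icc 1 n) (hc0 : mate c = 0)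
    (hg₀ : g₀ < m) (hz0 : z g₀ ≠ 0) (hzc : z g₀ ≠ c)
    (hlt : bundleValue m w z c c < α * (bundleValue m w z c (z g₀) - w c g₀))
    (hmax : ∀ g < m, z g ≠ 0 → z g ≠ c →
      bundleValue m w z c (z g) - w c g ≤ bundleValue m w z c (z g₀) - w c g₀)
    (hlarge : IsLarge n m w α x (Function.update z g₀ 0) (z g₀)) :
    ∃ μ' < μ, IsLoopState n m w α W₀ W₁ μ' x (Function.update z g₀ 0)
      (Function.update hold (z g₀) c)
      (Function.update (Function.update mate (hold (z g₀)) 0) c (z g₀)) := by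
  obtain ⟨R, hR, rfl⟩ := h.fuel
  refine ⟨_, ?_, h.phase.take_other hw hα hα1 hc hc0 hg₀ hz0 hzc hlt hmax, fun a ha => ?_, h.pos,
    h.welfare_ge, R, hR, rfl⟩
  · have h1 := card_unsettled_le n
      (Function.update (Function.update mate (hold (z g₀)) 0) c (z g₀))
    have h2 : numAllocated m (Function.update z g₀ 0) < numAllocated m z := by
      refine Finset.card_lt_card (Finset.ssubset_iff_of_subset ?_ |>.2 ⟨g₀, ?_, ?_⟩)
      · intro g hg
        simp only [Finset.mem_filter] at hg ⊢
        refine ⟨hg.1, ?_⟩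
        by_cases e : g = g₀
        · rwa [e]
        · rw [Function.update_of_ne e] at hg
          exact hg.2
      · exact Finset.mem_filter.2 ⟨Finset.mem_range.2 hg₀, hz0⟩
      · simp
    have h3 : (n + 1) * (numAllocated m (Function.update z g₀ 0) + 1) ≤
        (n + 1) * numAllocated m z := Nat.mul_le_mul_left _ h2
    rw [Nat.mul_succ] at h3
    unfold loopMeasure
    omega
  · by_cases e : a = z g₀
    · rwa [e]
    · have h1 := h.large a ha
      have ha0 : a ≠ 0 := by
        simp only [Finset.mem_Icc] at ha
        omega
      unfold IsLarge at h1 ⊢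
      rwa [bundleValue_remove_of_ne ha0 e]

/-- Each outcome of the rebalancing lowers `R + numAllocated m x`: an item is discarded, or one of
the `R` possible welfare gains is used up. -/
theorem IsLoopState.restart (hw : ∀ a g, 0 ≤ w a g) (hα : 0 ≤ α) (hα1 : α ≤ 1)
    (hW₁ : ∀ y : ℕ → ℕ, (∀ g < m, y g ≤ n) → welfare n m w y ≤ W₁)
    (h : IsLoopState n m w α W₀ W₁ μ x z hold mate) (hc : c ∈ Finset.Icc 1 n) (hc0 : mate c = 0)
    (hg₀ : g₀ < m) (hz0 : z g₀ ≠ 0) (hzc : z g₀ ≠ c)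
    (hlt : bundleValue m w z c c < α * (bundleValue m w z c (z g₀) - w c g₀))
    (hmax : ∀ g < m, z g ≠ 0 → z g ≠ c →
      bundleValue m w z c (z g) - w c g ≤ bundleValue m w z c (z g₀) - w c g₀)
    (hloss : ¬ IsLarge n m w α x (Function.update z g₀ 0) (z g₀))
    (hwalk : IsWalk n (Function.update hold (z g₀) c) (z g₀) nw j)
    (hend : j = z g₀ ∨ Function.update hold (z g₀) c j = 0)
    (hx' : ∀ g < m, x' g = if g = g₀ ∧ j = z g₀ then 0 else
      if Function.update z g₀ 0 g = 0 then x g else nw (Function.update z g₀ 0 g))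
    (hz' : ∀ g < m, z' g = x' g) (hh : ∀ b ≤ n, hold' b = 0)
    (hm : ∀ a ∈ Finset.Icc 1 n, mate' a = 0) :
    ∃ μ' < μ, IsLoopState n m w α W₀ W₁ μ' x' z' hold' mate' := by
  obtain ⟨R, hR, rfl⟩ := h.fuel
  obtain ⟨hle, hpos, hcase⟩ := h.phase.rebalance hw hα hα1 h.pos hg₀ hz0 hzc hlt
    (h.phase.take_other hw hα hα1 hc hc0 hg₀ hz0 hzc hlt hmax) hloss hwalk hend hx'
  have hW0 : 0 < welfare n m w x := Finset.prod_pos h.pos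
  have hρ : (0 : ℝ) < 1 / (3 * (n : ℝ)) := by
    have : (0 : ℝ) < n := by
      simp only [Finset.mem_Icc] at hc
      exact_mod_cast (by omega : 0 < n)
    positivity
  have hphase := IsPhase.init (w := w) (α := α) hle hz' hh hm
  have hlarge : ∀ a ∈ Finset.Icc 1 n, IsLarge n m w α x' z' a := fun a _ => IsLarge.init hw hα hz' a
  rcases hcase with ⟨h1, h2⟩ | ⟨h1, h2⟩
  · refine ⟨loopMeasure n m R x' z' mate', loopMeasure_init_lt (by omega), hphase, hlarge, hpos,
      h.welfare_ge.trans h1, R, hR.trans ?_, rfl⟩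
    exact mul_le_mul_of_nonneg_right h1 (by positivity)
  · have h3 : welfare n m w x < welfare n m w x' := by nlinarith
    obtain ⟨R', rfl⟩ : ∃ R', R = R' + 1 := by
      cases R with
      -- With no gain left, the welfare already equals or exceeds the upper bound `W₁`, so it cannot
      -- have grown strictly.
      | zero =>
        have := hW₁ x' hle
        rw [pow_zero, mul_one] at hR
        linarith
      | succ R' => exact ⟨R', rfl⟩
    refine ⟨loopMeasure n m R' x' z' mate', loopMeasure_init_lt (by omega), hphase, hlarge, hpos,
      h.welfare_ge.trans h3.le, R', hR.trans ?_, rfl⟩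
    calc welfare n m w x * (1 + 1 / (3 * (n : ℝ))) ^ (R' + 1)
        = (1 + 1 / (3 * (n : ℝ))) * welfare n m w x * (1 + 1 / (3 * (n : ℝ))) ^ R' := by ring
      _ ≤ _ := mul_le_mul_of_nonneg_right h1 (by positivity)

end Step

/-! ### One iteration -/

/-- One iteration of the main loop. -/
def iteration : Prog :=
  .seq findBest <| .seq choose <| .seq rematch <| .seq measureLoss <|
    .seq (.ite (.rlt 0 3) (.seq walk <| .seq shift initPhase) skip) findUnmatched

/-- The invariant of the main loop, for states of the machine. -/
def IsLoopInvariant (n m : ℕ) (w : ℕ → ℕ → ℝ) (W₀ W₁ : ℝ) (μ : ℕ) (s : State) : Prop :=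
  IsReady n m s ∧
    IsLoopState n m w (w 0 0) W₀ W₁ μ (s.narr 0) (s.narr 1) (s.narr 2) (s.narr 3) ∧
    ((s.nreg 5 = n + 1 ∧ ∀ a ∈ Finset.Icc 1 n, s.narr 3 a ≠ 0) ∨
      (s.nreg 5 ∈ Finset.Icc 1 n ∧ s.narr 3 (s.nreg 5) = 0))

theorem runs_findUnmatched_of_isLoopState {inp : ℕ → ℕ → ℝ} {n m μ : ℕ} {W₀ W₁ : ℝ} {s : State}
    (h : IsReady n m s) (hs : ∃ μ' < μ, IsLoopState n m inp (inp 0 0) W₀ W₁ μ'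
      (s.narr 0) (s.narr 1) (s.narr 2) (s.narr 3)) :
    Runs inp findUnmatched s (10 * (n + 2)) fun s' => ∃ μ' < μ,
      IsLoopInvariant n m inp W₀ W₁ μ' s' := by
  obtain ⟨μ', hμ', hs⟩ := hs
  refine (runs_findUnmatched h).mono le_rfl ?_
  rintro s' ⟨h', h1, h2⟩
  refine ⟨μ', hμ', h', by rwa [h1], ?_⟩
  rwa [h1]

theorem runs_iteration {inp : ℕ → ℕ → ℝ} (hinp : ∀ a g, 0 ≤ inp a g) (hα1 : inp 0 0 ≤ 1)
    {n m μ : ℕ} {W₀ W₁ : ℝ} {s : State}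
    (hW₁ : ∀ y : ℕ → ℕ, (∀ g < m, y g ≤ n) → welfare n m inp y ≤ W₁)
    (h : IsLoopInvariant n m inp W₀ W₁ μ s) (ht : s.nreg 5 < s.nreg 4) :
    Runs inp iteration s (200 * (n + m + 1) ^ 2) fun s' => ∃ μ' < μ,
      IsLoopInvariant n m inp W₀ W₁ μ' s' := by
  obtain ⟨hr, hs, hc⟩ := h
  obtain ⟨hc, hc0⟩ : s.nreg 5 ∈ Finset.Icc 1 n ∧ s.narr 3 (s.nreg 5) = 0 := by
    refine hc.resolve_left fun hcon => ?_
    rw [hr.succ_eq, hcon.1] at ht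
    exact absurd ht (lt_irrefl _)
  refine Runs.mono (B₁ := 40 * (m + 1) * (m + 1) + ((10 * (m + 1) + 5) + (4 + (20 * (n + m + 2) +
    (((20 * (n + 1) + (10 * (m + 2) + 4 * (n + m + 3))) + 1 + 1) + 10 * (n + 2))))))
    (Runs.seq ((runs_findBest hr).mono le_rfl ?_)) ?bound fun _ h => h
  case bound =>
    have h1 : (m + 1) * (m + 1) ≤ (n + m + 1) * (n + m + 1) :=
      Nat.mul_le_mul (by omega) (by omega)
    have h2 : n + m + 1 ≤ (n + m + 1) * (n + m + 1) := Nat.le_mul_self _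
    rw [pow_two, mul_assoc]
    omega
  rintro s₁ ⟨r1, a1, c1, hmax, hbest⟩
  refine Runs.seq ((runs_choose r1).mono le_rfl ?_)
  rintro s₂ ⟨r2, a20, a22, a23, c2, g2, hch⟩
  refine Runs.seq ((runs_rematch r2).mono le_rfl ?_)
  rintro s₃ ⟨r3, a30, a31, c3, b3, g3, a32, a33⟩
  refine Runs.seq ((runs_measureLoss r3).mono le_rfl ?_)
  rintro s₄ ⟨r4, a4, c4, b4, g4, hloss⟩
  rw [c1, a1] at hch
  rw [a22, a1, c2, c1] at a32
  rw [a23, a22, a1, c2, c1] at a33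
  rw [a20, a1] at a30
  rw [a30, a31, b3] at hloss
  have hn0 : ∀ b, 0 ≤ bundleValue m inp (s.narr 1) (s.nreg 5) b :=
    fun b => bundleValue_nonneg hinp _ _ b
  rcases hch with ⟨hlt, hb, hz⟩ | ⟨hlt, hb, hz⟩
  -- A best value of `0` cannot beat the nonnegative value of her own bundle, so an item was found.
  · have hbest := hbest.resolve_left fun e => by
      rw [e, mul_zero] at hlt
      exact absurd hlt (not_lt.2 (hn0 _))
    obtain ⟨hg, hz0, hzc, hval⟩ := hbest
    rw [hval] at hlt hmax
    rw [hb] at a32 a33 hloss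
    rw [hz] at hloss
    refine Runs.seq (Runs.ite (fun ht => ?_) (fun ht => ?_))
    · have hloss := hloss.1 (by simpa [Test.Holds, r4.rzero_eq] using ht)
      have hph := hs.phase.take_other hinp (hinp 0 0) hα1 hc hc0 hg hz0 hzc hlt hmax
      have hbm : s₄.nreg 6 ∈ Finset.Icc 1 n := by
        have h1 := hs.phase.sub _ hg
        have h2 := hs.phase.owner_le _ hg
        rw [b4, b3, hb, Finset.mem_Icc]
        omega
      have hM := hph.matching
      rw [← a32, ← a4] at hM
      have hcc : s₄.nreg 5 = s.nreg 5 := by rw [c4, c3, c2, c1]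
      have hbb : s₄.nreg 6 = s.narr 1 (s₁.nreg 7) := by rw [b4, b3, hb]
      have hgg : s₄.nreg 7 = s₁.nreg 7 := by rw [g4, g3, g2]
      refine Runs.seq ((runs_walk r4 hM hbm ?_ ?_ ?_).mono le_rfl ?_)
      · rw [hcc]
        simp only [Finset.mem_Icc] at hc
        omega
      · rw [hcc, hbb]
        exact hzc.symm
      · rw [a4, a32, hbb, hcc, Function.update_self]
      rintro s₅ ⟨r5, a50, a51, b5, g5, hwalk, hend⟩
      refine Runs.seq ((runs_shift r5).mono le_rfl ?_)
      rintro s₆ ⟨r6, hx'⟩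
      refine (runs_initPhase r6).mono le_rfl ?_
      rintro s₇ ⟨r7, a70, a71, a72, a73⟩
      refine runs_findUnmatched_of_isLoopState r7 ?_
      rw [a4, a32, hbb] at hwalk hend
      rw [g5, hgg, b5, hbb, a50, a51, a4, a30, a31, hz] at hx'
      refine hs.restart hinp (hinp 0 0) hα1 hW₁ hc hc0 hg hz0 hzc hlt hmax hloss hwalk hend
        (x' := s₇.narr 0) ?_ ?_ a72 a73
      · rw [a70]
        exact hx'
      · rw [a70]
        exact a71
    · have hloss : IsLarge n m inp (inp 0 0) (s.narr 0)
          (Function.update (s.narr 1) (s₁.nreg 7) 0) (s.narr 1 (s₁.nreg 7)) := by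
        by_contra hcon
        exact ht (by simpa [Test.Holds, r4.rzero_eq] using hloss.2 hcon)
      refine Runs.op (runs_findUnmatched_of_isLoopState
        (r4.of_eq (fun i hi => Function.update_of_ne (by omega) _ _) rfl) ?_)
      simp only [Op.apply, a4, a30, a31, a32, a33, hz]
      exact hs.take_other hinp (hinp 0 0) hα1 hc hc0 hg hz0 hzc hlt hmax hloss
  · rw [hb, hz] at hloss
    rw [hb] at a32 a33
    refine Runs.seq (Runs.ite (fun ht => ?_) (fun ht => ?_))
    -- When `c` takes her own bundle nothing is removed, so the invariant still says that bundle `c`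
    -- is large and the test fails.
    · exact absurd (hs.large _ hc) (hloss.1 (by simpa [Test.Holds, r4.rzero_eq] using ht))
    · refine Runs.op (runs_findUnmatched_of_isLoopState
        (r4.of_eq (fun i hi => Function.update_of_ne (by omega) _ _) rfl) ?_)
      simp only [Op.apply, a4, a30, a31, a32, a33, hz]
      refine hs.take_own hinp (hinp 0 0) hα1 hc hc0 fun g hg h0 h1 => ?_
      exact (mul_le_mul_of_nonneg_left (hmax g hg h0 h1) (hinp 0 0)).trans (not_lt.1 hlt)

/-! ### The complete program -/

/-- The agents get the bundles that they are matched to. -/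
def writeOutput : Prog :=
  forProg 10 0 1 <| .seq (.op (.nload 11 1 10)) <| .seq (.op (.nload 11 2 11)) <|
    .op (.nstore 0 10 11)

/-- Register `12` becomes nonzero if some agent has a bundle of value `0`. -/
def checkPositive : Prog :=
  .seq (.op (.nconst 12 0)) <| forProg 10 1 4 <| .seq (sumBundle 0 10 10 1) <|
    .ite (.rlt 0 1) skip (.op (.nconst 12 1))

/-- The algorithm for allocations in which every agent has a bundle of positive value. -/
def mainPhase : Prog :=
  .seq initPhase <| .seq findUnmatched <| .seq (.loop (.nlt 5 4) iteration) writeOutput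

/-- The empty allocation is written. -/
def clearOutput : Prog := forProg 10 0 1 (.op (.nstore 0 10 3))

/-- The constants are set up. -/
def setup : Prog :=
  .seq (.op (.nconst 2 1)) <| .seq (.op (.nconst 3 0)) <| .seq (.op (.nadd 4 0 2)) <|
    .op (.rconst 0 0)

/-- The algorithm that turns an allocation with a large Nash welfare into a fair one. -/
def fairProg : Prog :=
  .seq setup <| .seq checkPositive <| .ite (.neq 12 3) mainPhase clearOutput

section Specs

variable {inp : ℕ → ℕ → ℝ} {n m : ℕ} {s : State}

theorem runs_writeOutput (h : IsReady n m s) :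
    Runs inp writeOutput s (5 * (m + 1)) fun s' =>
      ∀ g < m, s'.narr 0 g = s.narr 2 (s.narr 1 g) := by
  refine Runs.mono (B₁ := (m + 1) * (3 + 2)) (Runs.forProg (K := m)
    (Inv := fun k s' => IsReady n m s' ∧ s'.narr 1 = s.narr 1 ∧ s'.narr 2 = s.narr 2 ∧
      ∀ g < k, s'.narr 0 g = s.narr 2 (s.narr 1 g))
    (by decide) (by decide) (Nat.zero_le _) h.m_eq h.one_eq ?_ ?_) (by omega) fun _ h => h.2.2.2
  · refine ⟨?_, rfl, rfl, by simp⟩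
    constructor <;> simp [State.setN, h.n_eq, h.m_eq, h.one_eq, h.zero_eq, h.succ_eq, h.rzero_eq]
  · rintro k s₁ - hk ⟨h, i1, i2, i0⟩ hk10 - -
    refine Runs.seq (Runs.op (Runs.seq (Runs.op (Runs.op ?_))))
    simp only [Op.apply, State.setN]
    refine ⟨by simp [hk10], by simp [h.m_eq], by simp [h.one_eq], ?_, by simp [i1], by simp [i2],
      fun g hg => ?_⟩
    · constructor <;> simp [h.n_eq, h.m_eq, h.one_eq, h.zero_eq, h.succ_eq, h.rzero_eq]
    · by_cases e : g = k
      · simp [e, hk10, i1, i2]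
      · simpa [hk10, e] using i0 g (by omega)

theorem runs_clearOutput (h : IsReady n m s) :
    Runs inp clearOutput s (3 * (m + 1)) fun s' => ∀ g < m, s'.narr 0 g = 0 := by
  refine Runs.mono (B₁ := (m + 1) * (1 + 2)) (Runs.forProg (K := m)
    (Inv := fun k s' => IsReady n m s' ∧ ∀ g < k, s'.narr 0 g = 0)
    (by decide) (by decide) (Nat.zero_le _) h.m_eq h.one_eq ?_ ?_) (by omega) fun _ h => h.2
  · refine ⟨?_, by simp⟩
    constructor <;> simp [State.setN, h.n_eq, h.m_eq, h.one_eq, h.zero_eq, h.succ_eq, h.rzero_eq]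
  · rintro k s₁ - hk ⟨h, i0⟩ hk10 - -
    refine Runs.op ?_
    simp only [Op.apply, State.setN]
    refine ⟨by simp [hk10], by simp [h.m_eq], by simp [h.one_eq], ?_, fun g hg => ?_⟩
    · constructor <;> simp [h.n_eq, h.m_eq, h.one_eq, h.zero_eq, h.succ_eq, h.rzero_eq]
    · by_cases e : g = k
      · simp [e, hk10, h.zero_eq]
      · simpa [hk10, e] using i0 g (by omega)

theorem runs_checkPositive (h : IsReady n m s) :
    Runs inp checkPositive s (1 + (n + 2) * (10 * (m + 1) + 5)) fun s' =>
      IsReady n m s' ∧ s'.narr = s.narr ∧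
      ((s'.nreg 12 = 0 ∧ AllPositive n m inp (s.narr 0)) ∨
        (s'.nreg 12 ≠ 0 ∧ ∃ a ∈ Finset.Icc 1 n, ¬ 0 < bundleValue m inp (s.narr 0) a a)) := by
  refine Runs.mono (B₁ := 1 + (n + 1 + 1) * (10 * (m + 1) + (1 + 1 + 1) + 2))
    (Runs.seq (Runs.op (Runs.forProg (K := n + 1)
    (Inv := fun k s' => IsReady n m s' ∧ s'.narr = s.narr ∧
      ((s'.nreg 12 = 0 ∧ ∀ a ∈ Finset.Ico 1 k, 0 < bundleValue m inp (s.narr 0) a a) ∨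
        (s'.nreg 12 ≠ 0 ∧ ∃ a ∈ Finset.Icc 1 n, ¬ 0 < bundleValue m inp (s.narr 0) a a)))
    (by decide) (by decide) (by omega) h.succ_eq h.one_eq ?_ ?_))) (le_of_eq (by ring))
    fun s' hs' => ?_
  · refine ⟨?_, rfl, Or.inl ?_⟩
    · constructor <;>
        simp [Op.apply, State.setN, h.n_eq, h.m_eq, h.one_eq, h.zero_eq, h.succ_eq, h.rzero_eq]
    · simp [Op.apply, State.setN]
  · rintro k s₁ hk1 hk ⟨h, i0, i1⟩ hk10 - -
    refine Runs.seq ((runs_sumBundle h.m_eq h.one_eq (by decide) (by decide) (by decide)).mono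
      le_rfl ?_)
    rintro s₂ ⟨e1, e2, e3, e4⟩
    rw [i0, hk10] at e4
    have e0 : s₂.rreg 0 = 0 := by rw [e3 0 (by decide) (by decide), h.rzero_eq]
    refine Runs.ite (fun hb => Runs.op ?_) (fun hb => Runs.op ?_)
    · have hb : 0 < bundleValue m inp (s.narr 0) k k := by
        simpa [Test.Holds, e0, e4] using hb
      simp only [Op.apply, State.setN]
      refine ⟨by simp [e2, hk10], by simp [e2, h.succ_eq], by simp [e2, h.one_eq], ?_,
        by rw [e1, i0], ?_⟩
      · constructor <;>
          simp [e2, e0, h.n_eq, h.m_eq, h.one_eq, h.zero_eq, h.succ_eq]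
      · rcases i1 with ⟨i1, i2⟩ | i1
        · left
          refine ⟨by simp [e2, i1], fun a ha => ?_⟩
          by_cases e : a = k
          · rwa [e]
          · simp only [Finset.mem_Ico] at ha
            exact i2 a (Finset.mem_Ico.2 (by omega))
        · right
          simpa [e2] using i1
    · have hb : ¬ 0 < bundleValue m inp (s.narr 0) k k := by
        simpa [Test.Holds, e0, e4] using hb
      simp only [Op.apply, State.setN]
      refine ⟨by simp [e2, hk10], by simp [e2, h.succ_eq], by simp [e2, h.one_eq], ?_,
        by rw [e1, i0], Or.inr ⟨by simp, k, Finset.mem_Icc.2 (by omega), hb⟩⟩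
      constructor <;>
        simp [e2, e0, h.n_eq, h.m_eq, h.one_eq, h.zero_eq, h.succ_eq]
  · exact hs'

theorem runs_mainPhase (hinp : ∀ a g, 0 ≤ inp a g) (hα1 : inp 0 0 ≤ 1) (h : IsReady n m s)
    {W₁ : ℝ} {R : ℕ} (hx : ∀ g < m, s.narr 0 g ≤ n) (hpos : AllPositive n m inp (s.narr 0))
    (hW₁ : ∀ y : ℕ → ℕ, (∀ g < m, y g ≤ n) → welfare n m inp y ≤ W₁)
    (hR : W₁ ≤ welfare n m inp (s.narr 0) * (1 + 1 / (3 * (n : ℝ))) ^ R) :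
    Runs inp mainPhase s (4 * (n + m + 3) + (10 * (n + 2) +
        (((R + m + 1) * ((n + 1) * (m + 1))) * (200 * (n + m + 1) ^ 2 + 1) + 1 + 5 * (m + 1))))
      fun s' => ∃ (μ : ℕ) (x z hold mate : ℕ → ℕ),
        IsLoopState n m inp (inp 0 0) (welfare n m inp (s.narr 0)) W₁ μ x z hold mate ∧
          (∀ a ∈ Finset.Icc 1 n, mate a ≠ 0) ∧ ∀ g < m, s'.narr 0 g = hold (z g) := by
  refine Runs.seq ((runs_initPhase h).mono le_rfl ?_)
  rintro s₁ ⟨h1, a0, a1, a2, a3⟩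
  have hstate : IsLoopState n m inp (inp 0 0) (welfare n m inp (s.narr 0)) W₁
      (loopMeasure n m R (s₁.narr 0) (s₁.narr 1) (s₁.narr 3))
      (s₁.narr 0) (s₁.narr 1) (s₁.narr 2) (s₁.narr 3) := by
    rw [a0]
    exact ⟨.init hx a1 a2 a3, fun a _ => .init hinp (hinp 0 0) a1 a, hpos, le_rfl, R, hR, rfl⟩
  refine Runs.seq ((runs_findUnmatched_of_isLoopState h1 ⟨_, Nat.lt_succ_self _, hstate⟩).mono
    le_rfl ?_)
  rintro s₂ ⟨μ, hμ, hinv⟩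
  refine Runs.seq ((Runs.loop (b := .nlt 5 4)
    (Inv := IsLoopInvariant n m inp _ W₁) (fun μ s hs ht => runs_iteration hinp hα1 hW₁ hs ht) μ s₂ hinv).mono
    ?_ ?_)
  · refine Nat.add_le_add_right (Nat.mul_le_mul_right _ ?_) _
    have h2 := card_unsettled_le n (s₁.narr 3)
    have h3 : (n + 1) * numAllocated m (s₁.narr 1) ≤ (n + 1) * m :=
      Nat.mul_le_mul_left _ (numAllocated_le m _)
    have h4 : (R + numAllocated m (s₁.narr 0)) * ((n + 1) * m + n + 1) ≤
        (R + m) * ((n + 1) * m + n + 1) :=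
      Nat.mul_le_mul_right _ (Nat.add_le_add_left (numAllocated_le m _) _)
    have h5 : (R + m + 1) * ((n + 1) * (m + 1)) =
        (R + m) * ((n + 1) * m + n + 1) + ((n + 1) * m + n + 1) := by ring
    unfold loopMeasure at hμ
    omega
  · rintro s₃ ⟨ht, μ', h3, hs, hmate⟩
    refine (runs_writeOutput h3).mono le_rfl fun s₄ hout => ?_
    refine ⟨μ', _, _, _, _, hs, ?_, hout⟩
    rcases hmate with hmate | hmate
    · exact hmate.2
    · refine absurd ?_ ht
      have := (Finset.mem_Icc.1 hmate.1).2
      show s₃.nreg 5 < s₃.nreg 4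
      rw [h3.succ_eq]
      omega

theorem runs_setup (hn : s.nreg 0 = n) (hm : s.nreg 1 = m) :
    Runs inp setup s 4 fun s' => IsReady n m s' ∧ s'.narr = s.narr := by
  refine Runs.seq (Runs.op (Runs.seq (Runs.op (Runs.seq (Runs.op (Runs.op ?_))))))
  refine ⟨?_, rfl⟩
  constructor <;> simp [Op.apply, hn, hm]

/-- The number `n * q * n` is the budget of welfare gains. Multiplicative growth bounds their number
only if the initial product is positive, hence the separate treatment of agents with value `0`. -/
theorem runs_fairProg (hinp : ∀ a g, 0 ≤ inp a g) (hα1 : inp 0 0 ≤ 1)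
    (hn : s.nreg 0 = n) (hm : s.nreg 1 = m)
    {W₁ : ℝ} {q : ℕ} (hq : 1 ≤ q) (hx : ∀ g < m, s.narr 0 g ≤ n)
    (hW₁ : ∀ y : ℕ → ℕ, (∀ g < m, y g ≤ n) → welfare n m inp y ≤ W₁)
    (hR : W₁ ≤ welfare n m inp (s.narr 0) * (1 + 1 / (3 * (n : ℝ))) ^ (n * q * n)) :
    Runs inp fairProg s (700 * (n + m + 1) ^ 6 * q) fun s' =>
      (∃ (μ : ℕ) (x z hold mate : ℕ → ℕ),
        IsLoopState n m inp (inp 0 0) (welfare n m inp (s.narr 0)) W₁ μ x z hold mate ∧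
          (∀ a ∈ Finset.Icc 1 n, mate a ≠ 0) ∧ ∀ g < m, s'.narr 0 g = hold (z g)) ∨
      ((∃ a ∈ Finset.Icc 1 n, ¬ 0 < bundleValue m inp (s.narr 0) a a) ∧
        ∀ g < m, s'.narr 0 g = 0) := by
  refine Runs.mono (Runs.seq ((runs_setup hn hm).mono le_rfl ?_)) (B₁ := 4 +
    ((1 + (n + 2) * (10 * (m + 1) + 5)) + ((4 * (n + m + 3) + (10 * (n + 2) +
        (((n * q * n + m + 1) * ((n + 1) * (m + 1))) * (200 * (n + m + 1) ^ 2 + 1) + 1 +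
          5 * (m + 1)))) + (3 * (m + 1)) + 1))) ?bound fun _ h => h
  case bound =>
    set L := n + m + 1 with hL
    have h1 : (n + 1) * (m + 1) ≤ L * L := Nat.mul_le_mul (by omega) (by omega)
    have h2 : n * q * n + m + 1 ≤ 2 * (L * L * q) := by
      have h3 : n * n ≤ L * L := Nat.mul_le_mul (by omega) (by omega)
      have h4 : n * q * n ≤ L * L * q := by
        rw [mul_right_comm]
        exact Nat.mul_le_mul_right _ h3
      have h5 : L ≤ L * L * q := by
        calc L = L * 1 * 1 := by ring
          _ ≤ L * L * q := Nat.mul_le_mul (Nat.mul_le_mul_left _ (by omega)) hq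
      omega
    have h3 : 200 * L ^ 2 + 1 ≤ 201 * (L * L) := by
      have : 1 * 1 ≤ L * L := Nat.mul_le_mul (by omega) (by omega)
      rw [pow_two]
      omega
    have h4 : (n * q * n + m + 1) * ((n + 1) * (m + 1)) * (200 * L ^ 2 + 1) ≤
        402 * (L ^ 6 * q) :=
      (Nat.mul_le_mul (Nat.mul_le_mul h2 h1) h3).trans_eq (by ring)
    have h5 : (n + 2) * (10 * (m + 1) + 5) ≤ 30 * (L * L) :=
      (Nat.mul_le_mul (show n + 2 ≤ 2 * L by omega)
        (show 10 * (m + 1) + 5 ≤ 15 * L by omega)).trans_eq (by ring)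
    have h6 : L * L ≤ L ^ 6 * q := by
      calc L * L = L ^ 2 * 1 := by ring
        _ ≤ L ^ 6 * q := Nat.mul_le_mul (Nat.pow_le_pow_right (by omega) (by omega)) hq
    have h7 : L ≤ L * L := Nat.le_mul_self L
    rw [mul_assoc 700]
    omega
  rintro s₁ ⟨h1, a1⟩
  refine Runs.seq ((runs_checkPositive h1).mono le_rfl ?_)
  rintro s₂ ⟨h2, a2, hcase⟩
  rw [a1] at a2 hcase
  refine Runs.ite (fun hb => ?_) (fun hb => ?_)
  · have hb : s₂.nreg 12 = 0 := by simpa [Test.Holds, h2.zero_eq] using hb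
    have hpos : AllPositive n m inp (s.narr 0) :=
      (hcase.resolve_right fun hcon => hcon.1 hb).2
    refine (runs_mainPhase (W₁ := W₁) (R := n * q * n) hinp hα1 h2 (by rwa [a2]) (by rwa [a2]) hW₁
      (by rwa [a2])).mono le_rfl fun s' hs' => Or.inl ?_
    rwa [a2] at hs'
  · have hb : s₂.nreg 12 ≠ 0 := by simpa [Test.Holds, h2.zero_eq] using hb
    exact (runs_clearOutput h2).mono le_rfl fun s' hs' =>
      Or.inr ⟨(hcase.resolve_left fun hcon => hb hcon.1).2, hs'⟩

end Specs

/-! ### Fairness and welfare of the output, and the number of welfare gains -/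

section Output

variable {n m μ : ℕ} {w : ℕ → ℕ → ℝ} {α W₀ W₁ : ℝ} {x y z hold mate : ℕ → ℕ}

/-- If all agents are matched, then every agent gets the bundle that she is matched to. -/
theorem IsPhase.bundleValue_output (h : IsPhase n m w α x z hold mate)
    (hall : ∀ a ∈ Finset.Icc 1 n, mate a ≠ 0) (hy : ∀ g < m, y g = hold (z g)) (a : ℕ) {b : ℕ}
    (hb : b ∈ Finset.Icc 1 n) : bundleValue m w y a b = bundleValue m w z a (mate b) := by
  have key : ∀ g < m, y g = b ↔ z g = mate b := by
    intro g hg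
    rw [hy g hg]
    by_cases h0 : z g = 0
    · rw [h0, h.matching.hold_zero]
      have := hall b hb
      simp only [Finset.mem_Icc] at hb
      omega
    · have hz : z g ∈ Finset.Icc 1 n := by
        have h1 := h.sub g hg
        have h2 := h.owner_le g hg
        rw [Finset.mem_Icc]
        omega
      exact (h.matching.mate_iff b hb _ hz).symm.trans eq_comm
  exact Finset.sum_congr rfl fun g hg => by simp only [key g (Finset.mem_range.1 hg)]

theorem IsPhase.efx_output (h : IsPhase n m w α x z hold mate)
    (hall : ∀ a ∈ Finset.Icc 1 n, mate a ≠ 0) (hy : ∀ g < m, y g = hold (z g)) {a b : ℕ}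
    (ha : a ∈ Finset.Icc 1 n) (hb : b ∈ Finset.Icc 1 n) {g : ℕ} (hg : g < m) (hyg : y g = b) :
    α * (bundleValue m w y a b - w a g) ≤ bundleValue m w y a a := by
  rw [h.bundleValue_output hall hy a ha, h.bundleValue_output hall hy a hb]
  have hb0 : b ≠ 0 := by
    simp only [Finset.mem_Icc] at hb
    omega
  have h0 : z g ≠ 0 := by
    intro e
    rw [hy g hg, e, h.matching.hold_zero] at hyg
    exact hb0 hyg.symm
  have hz : z g ∈ Finset.Icc 1 n := by
    have h1 := h.sub g hg
    have h2 := h.owner_le g hg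
    rw [Finset.mem_Icc]
    omega
  have hmz : mate b = z g := (h.matching.mate_iff b hb _ hz).2 (by rw [← hy g hg, hyg])
  rw [hmz]
  exact h.efx a ha (hall a ha) g hg h0

/-- With `δ = α/(2n)`, the product of `(1 + δ)^n` and `(1 - δ)^n` is at most `1`, and Bernoulli
gives `(1 - δ)^n ≥ 1 - α/2`. It remains that `(1 + α)(1 - α/2) ≥ 1` on `[0, 1]`. -/
theorem one_add_div_pow_le {n : ℕ} (hn : 1 ≤ n) {α : ℝ} (hα : 0 ≤ α) (hα1 : α ≤ 1) :
    (1 + α / (2 * n)) ^ n ≤ 1 + α := by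
  have hn' : (1 : ℝ) ≤ n := by exact_mod_cast hn
  have hδ : α / (2 * n) ≤ 1 := by
    rw [div_le_one (by linarith)]
    linarith
  have hδ0 : 0 ≤ α / (2 * n) := by positivity
  have h1 : 1 - α / 2 ≤ (1 - α / (2 * n)) ^ n := by
    have := one_add_mul_le_pow (a := -(α / (2 * n))) (by linarith) n
    have h2 : (n : ℝ) * -(α / (2 * n)) = -(α / 2) := by
      field_simp
    rw [h2] at this
    simpa [sub_eq_add_neg] using this
  have h3 : (1 + α / (2 * n)) ^ n * (1 - α / (2 * n)) ^ n ≤ 1 := by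
    rw [← mul_pow]
    refine pow_le_one₀ (mul_nonneg (by linarith) (by linarith)) ?_
    nlinarith
  have h4 : 0 ≤ (1 + α / (2 * n)) ^ n := by positivity
  have h5 : (1 + α / (2 * n)) ^ n * (1 - α / 2) ≤ 1 :=
    (mul_le_mul_of_nonneg_left h1 h4).trans h3
  nlinarith

/-- Every agent loses at most a factor `κ = (1 + α)(1 + α/(2n))`, and the agent provided by
`surplus` loses nothing. So the total loss is `κ^(n-1)`, which is at most `(1 + α)^n`. -/
theorem IsLoopState.welfare_output (hw : ∀ a g, 0 ≤ w a g) (hα : 0 ≤ α) (hα1 : α ≤ 1)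
    (h : IsLoopState n m w α W₀ W₁ μ x z hold mate)
    (hall : ∀ a ∈ Finset.Icc 1 n, mate a ≠ 0) (hy : ∀ g < m, y g = hold (z g)) :
    W₀ ≤ (1 + α) ^ n * welfare n m w y := by
  refine h.welfare_ge.trans ?_
  have hy' : welfare n m w y = ∏ a ∈ Finset.Icc 1 n, bundleValue m w z a (mate a) :=
    Finset.prod_congr rfl fun a ha => h.phase.bundleValue_output hall hy a ha
  rw [hy']
  have hnn := bundleValue_nonneg (m := m) hw
  rcases h.phase.surplus with ⟨b, hb, hb0⟩ | hn | ⟨a₀, ha₀, hs⟩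
  · exfalso
    -- With the roles of bundles and agents exchanged, all agents being matched forces all bundles
    -- to be held. The update at `0` supplies the normalisation that is required of `hold` only.
    have hM : IsMatching n (Function.update mate 0 0) hold := by
      refine ⟨Function.update_self .., fun a ha => ?_, h.phase.matching.hold_le, fun b hb a ha => ?_⟩
      · rw [Function.update_of_ne (by simp only [Finset.mem_Icc] at ha; omega)]
        exact h.phase.matching.mate_le a ha
      · rw [Function.update_of_ne (by simp only [Finset.mem_Icc] at ha; omega)]
        exact (h.phase.matching.mate_iff a ha b hb).symm
    refine hM.mate_ne_zero_of_forall_hold (fun a ha => ?_) b hb hb0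
    rw [Function.update_of_ne (by simp only [Finset.mem_Icc] at ha; omega)]
    exact hall a ha
  · subst hn
    simp [welfare]
  · have hn : 1 ≤ n := by
      simp only [Finset.mem_Icc] at ha₀
      omega
    have hn0 : (0 : ℝ) < n := by exact_mod_cast hn
    set κ := (1 + α) * (1 + α / (2 * n)) with hκ
    have hκ1 : 0 ≤ κ := by positivity
    have hbound : ∀ a ∈ Finset.Icc 1 n,
        bundleValue m w x a a ≤ κ * bundleValue m w z a (mate a) := by
      intro a ha
      have h1 : bundleValue m w z a a ≤ bundleValue m w z a (mate a) := by
        by_cases e : mate a = a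
        · rw [e]
        · have h2 := h.phase.prefer a ha (hall a ha) e
          have h3 := hnn z a (mate a)
          nlinarith
      have h2 : 2 * n * bundleValue m w x a a ≤ 2 * n * (κ * bundleValue m w z a a) := by
        have h3 : 2 * n * (κ * bundleValue m w z a a) =
            (2 * n + α) * ((1 + α) * bundleValue m w z a a) := by
          rw [hκ]
          field_simp
        rw [h3]
        exact h.large a ha
      exact (le_of_mul_le_mul_left h2 (by positivity)).trans (mul_le_mul_of_nonneg_left h1 hκ1)
    have hprod : welfare n m w x ≤ κ ^ (n - 1) *
        ∏ a ∈ Finset.Icc 1 n, bundleValue m w z a (mate a) := by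
      unfold welfare
      rw [← Finset.mul_prod_erase _ _ ha₀,
        ← Finset.mul_prod_erase _ (fun a => bundleValue m w z a (mate a)) ha₀, mul_left_comm]
      have hcard : κ ^ (n - 1) = ∏ _a ∈ (Finset.Icc 1 n).erase a₀, κ := by
        rw [Finset.prod_const, Finset.card_erase_of_mem ha₀]
        simp
      rw [hcard, ← Finset.prod_mul_distrib]
      refine mul_le_mul hs ?_ (Finset.prod_nonneg fun a _ => hnn x a a) (hnn z _ _)
      exact Finset.prod_le_prod (fun a _ => hnn x a a) fun a ha =>
        hbound a (Finset.mem_of_mem_erase ha)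
    refine hprod.trans (mul_le_mul_of_nonneg_right ?_ (Finset.prod_nonneg fun a _ => hnn z _ _))
    have h1 : (1 + α / (2 * n)) ^ (n - 1) ≤ 1 + α := by
      refine (pow_le_pow_right₀ ?_ (Nat.sub_le n 1)).trans (one_add_div_pow_le hn hα hα1)
      have : 0 ≤ α / (2 * n) := by positivity
      linarith
    calc κ ^ (n - 1) = (1 + α) ^ (n - 1) * (1 + α / (2 * n)) ^ (n - 1) := mul_pow _ _ _
      _ ≤ (1 + α) ^ (n - 1) * (1 + α) := mul_le_mul_of_nonneg_left h1 (by positivity)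
      _ = (1 + α) ^ n := by rw [← pow_succ, Nat.sub_add_cancel hn]

end Output

/-- Two applications of Bernoulli: `n` gains multiply the welfare by at least `4/3`, and `q` such
blocks by at least `1 + q/3 ≥ 1/β`. Raising to the power `n` covers the passage from the geometric
mean to the product. -/
theorem inv_pow_le_of_three_div_le {n q : ℕ} (hn : 1 ≤ n) {β : ℝ} (hβ : 0 < β)
    (hq : 3 / β ≤ q) : (1 / β) ^ n ≤ (1 + 1 / (3 * (n : ℝ))) ^ (n * q * n) := by
  have hn0 : (0 : ℝ) < n := by exact_mod_cast hn
  rw [pow_mul, pow_mul]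
  refine pow_le_pow_left₀ (by positivity) ?_ n
  have h1 : 1 + (1 : ℝ) / 3 ≤ (1 + 1 / (3 * (n : ℝ))) ^ n := by
    have h0 : (0 : ℝ) ≤ 1 / (3 * (n : ℝ)) := by positivity
    have := one_add_mul_le_pow (a := 1 / (3 * (n : ℝ))) (by linarith) n
    have h2 : (n : ℝ) * (1 / (3 * n)) = 1 / 3 := by
      field_simp
    rwa [h2] at this
  have h2 : 1 + (q : ℝ) * (1 / 3) ≤ (1 + 1 / 3) ^ q := one_add_mul_le_pow (by norm_num) q
  have h3 : 1 / β ≤ 1 + (q : ℝ) * (1 / 3) := by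
    have : 3 / β = 3 * (1 / β) := by ring
    linarith
  exact h3.trans (h2.trans (pow_le_pow_left₀ (by norm_num) h1 q))

/-! ### Translation between owner arrays and allocations -/

section Encoding

variable {n m : ℕ} {v : Fin n → Finset (Fin m) → ℝ} {α : ℝ}

theorem IsAdditive.eq_sum {f : Finset (Fin m) → ℝ} (hf : IsAdditive f) (S : Finset (Fin m)) :
    f S = ∑ g ∈ S, f {g} := by
  induction S using Finset.induction_on with
  | empty =>
    have := hf ∅ ∅ (Finset.disjoint_empty_left _)
    rw [Finset.union_empty] at this
    rw [Finset.sum_empty]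
    linarith
  | insert a S ha ih =>
    rw [Finset.sum_insert ha, ← ih, Finset.insert_eq, hf _ _ (Finset.disjoint_singleton_left.2 ha)]

theorem IsAdditive.sdiff_singleton {f : Finset (Fin m) → ℝ} (hf : IsAdditive f)
    {S : Finset (Fin m)} {g : Fin m} (hg : g ∈ S) : f (S \ {g}) = f S - f {g} := by
  have := hf (S \ {g}) {g} Finset.sdiff_disjoint
  rw [Finset.sdiff_union_of_subset (Finset.singleton_subset_iff.2 hg)] at this
  linarith

theorem inputTable_nonneg (hv : ∀ i S, 0 ≤ v i S) (hα : 0 ≤ α) (a g : ℕ) :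
    0 ≤ inputTable v α a g := by
  cases a with
  | zero =>
    simp only [inputTable]
    split_ifs <;> simp [hα]
  | succ i =>
    simp only [inputTable]
    split_ifs
    · exact hv _ _
    · exact le_rfl

theorem inputTable_succ (i : Fin n) (g : Fin m) :
    inputTable v α ((i : ℕ) + 1) g = v i {g} := by
  simp [inputTable]

theorem bundleValue_inputTable (hadd : ∀ i, IsAdditive (v i)) (y : ℕ → ℕ) (i j : Fin n) :
    bundleValue m (inputTable v α) y (i + 1) (j + 1) = v i (decodeAlloc n m y j) := by
  rw [(hadd i).eq_sum, bundleValue, Finset.sum_range, decodeAlloc, Finset.sum_filter]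
  simp only [inputTable_succ]

theorem succ_mem_Icc (i : Fin n) : (i : ℕ) + 1 ∈ Finset.Icc 1 n :=
  Finset.mem_Icc.2 ⟨by omega, i.isLt⟩

theorem exists_of_mem_Icc {a : ℕ} (ha : a ∈ Finset.Icc 1 n) : ∃ i : Fin n, a = i + 1 := by
  simp only [Finset.mem_Icc] at ha
  exact ⟨⟨a - 1, by omega⟩, by simp only; omega⟩

theorem welfare_inputTable (hadd : ∀ i, IsAdditive (v i)) (y : ℕ → ℕ) :
    welfare n m (inputTable v α) y = ∏ i, v i (decodeAlloc n m y i) := by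
  unfold welfare
  refine (Finset.prod_bij (fun (i : Fin n) _ => (i : ℕ) + 1) (fun i _ => succ_mem_Icc i)
    (fun i _ j _ h => Fin.ext (by omega)) (fun a ha => ?_)
    (fun i _ => (bundleValue_inputTable hadd y i i).symm)).symm
  obtain ⟨i, rfl⟩ := exists_of_mem_Icc ha
  exact ⟨i, Finset.mem_univ _, rfl⟩

theorem isAllocation_decodeAlloc (y : ℕ → ℕ) : IsAllocation (decodeAlloc n m y) := by
  intro i j hij
  refine Finset.disjoint_left.2 fun g hi hj => hij (Fin.ext ?_)
  simp only [decodeAlloc, Finset.mem_filter, Finset.mem_univ, true_and] at hi hj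
  omega

theorem encodeAlloc_le {X : Fin n → Finset (Fin m)} (hX : IsAllocation X) (g : ℕ) :
    encodeAlloc X g ≤ n := by
  unfold encodeAlloc
  split_ifs with hg
  · by_cases hex : ∃ j, (⟨g, hg⟩ : Fin m) ∈ X j
    · obtain ⟨j, hj⟩ := hex
      rw [Finset.sum_eq_single j]
      · rw [if_pos hj]
        exact j.isLt
      · intro k _ hk
        rw [if_neg (Finset.disjoint_right.1 (hX k j hk) hj)]
      · simp
    · push Not at hex
      simp [hex]
  · exact Nat.zero_le _

theorem nashWelfare_nonneg (hv : ∀ i S, 0 ≤ v i S) (X : Fin n → Finset (Fin m)) :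
    0 ≤ nashWelfare v X :=
  Finset.prod_nonneg fun i _ => Real.rpow_nonneg (hv i _) _

theorem nashWelfare_pow (hv : ∀ i S, 0 ≤ v i S) (hn : n ≠ 0) (X : Fin n → Finset (Fin m)) :
    nashWelfare v X ^ n = ∏ i, v i (X i) := by
  unfold nashWelfare
  rw [← Finset.prod_pow]
  refine Finset.prod_congr rfl fun i _ => ?_
  rw [one_div, Real.rpow_inv_natCast_pow (hv i _) hn]

theorem nashWelfare_eq_zero {X : Fin n → Finset (Fin m)} {i : Fin n} (h : v i (X i) = 0) :
    nashWelfare v X = 0 := by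
  refine Finset.prod_eq_zero (Finset.mem_univ i) ?_
  have : (n : ℝ) ≠ 0 := by
    have := i.isLt
    exact_mod_cast (by omega : n ≠ 0)
  rw [h, Real.zero_rpow (one_div_ne_zero this)]

end Encoding

end FairDiv

/-! ### The main theorem -/

theorem mainTheorem7 :
    ∃ (P : FairDiv.Prog) (p : Polynomial ℕ),
      ∀ (n m : ℕ) (v : Fin n → Finset (Fin m) → ℝ),
        (∀ i S, 0 ≤ v i S) → (∀ i, FairDiv.IsAdditive (v i)) →
      ∀ α : ℝ, 0 ≤ α → α ≤ 1 →
      ∀ β : ℝ, 0 < β → β < 1 →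
      ∀ X : Fin n → Finset (Fin m), FairDiv.IsAllocation X → FairDiv.IsApproxMNW v β X →
        ∃ (t : ℕ) (s : FairDiv.State),
          FairDiv.Exec (FairDiv.inputTable v α) P (FairDiv.startState X) t s ∧
          (t : ℝ) ≤ ((p.eval (n + m) : ℕ) : ℝ) / β ∧
          FairDiv.IsAllocation (s.output n m) ∧
          FairDiv.IsEFX v α (s.output n m) ∧
          FairDiv.IsApproxMNW v (β / (α + 1)) (s.output n m) := by
  -- The program takes at most `700 * (n + m + 1) ^ 6 * ⌈3 / β⌉₊` steps, and `⌈3 / β⌉₊ ≤ 4 / β`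
  -- because β < 1; hence 2800 = 700 · 4.
  refine ⟨FairDiv.fairProg, 2800 * (Polynomial.X + 1) ^ 6, ?_⟩
  intro n m v hv hadd α hα hα1 β hβ hβ1 X hX hXβ
  have hinp := FairDiv.inputTable_nonneg (v := v) hv hα
  have h00 : FairDiv.inputTable v α 0 0 = α := by simp [FairDiv.inputTable]
  have hdec := FairDiv.decodeAlloc_encodeAlloc X hX
  obtain ⟨O, hO⟩ := FairDiv.exists_isMNW v
  have hx0 : (FairDiv.startState X).narr 0 = FairDiv.encodeAlloc X := by
    funext g
    simp [FairDiv.startState]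
  have hq3 : 3 / β ≤ ⌈3 / β⌉₊ := Nat.le_ceil _
  have hq1 : 1 ≤ ⌈3 / β⌉₊ := Nat.one_le_iff_ne_zero.2 (Nat.ceil_pos.2 (by positivity)).ne'
  have hq4 : (⌈3 / β⌉₊ : ℝ) ≤ 4 / β := by
    have h1 := (Nat.ceil_lt_add_one (show 0 ≤ 3 / β by positivity)).le
    have h2 : 1 ≤ 1 / β := by
      rw [le_div_iff₀ hβ]
      linarith
    have h3 : 4 / β = 3 / β + 1 / β := by ring
    linarith
  have hW₁ : ∀ y : ℕ → ℕ, (∀ g < m, y g ≤ n) →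
      FairDiv.welfare n m (FairDiv.inputTable v α) y ≤ ∏ i, v i (O i) := by
    intro y _
    rw [FairDiv.welfare_inputTable hadd]
    rcases Nat.eq_zero_or_pos n with hn | hn
    · subst hn
      simp
    · rw [← FairDiv.nashWelfare_pow hv hn.ne', ← FairDiv.nashWelfare_pow hv hn.ne']
      exact pow_le_pow_left₀ (FairDiv.nashWelfare_nonneg hv _)
        (hO.2 _ (FairDiv.isAllocation_decodeAlloc y)) n
  have hR : ∏ i, v i (O i) ≤ FairDiv.welfare n m (FairDiv.inputTable v α)
      ((FairDiv.startState X).narr 0) * (1 + 1 / (3 * (n : ℝ))) ^ (n * ⌈3 / β⌉₊ * n) := by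
    rw [FairDiv.welfare_inputTable hadd, hx0, hdec]
    rcases Nat.eq_zero_or_pos n with hn | hn
    · subst hn
      simp
    · rw [← FairDiv.nashWelfare_pow hv hn.ne', ← FairDiv.nashWelfare_pow hv hn.ne']
      have h1 : FairDiv.nashWelfare v O ^ n ≤ FairDiv.nashWelfare v X ^ n * (1 / β) ^ n := by
        rw [← mul_pow]
        refine pow_le_pow_left₀ (FairDiv.nashWelfare_nonneg hv _) ?_ n
        rw [mul_one_div, le_div_iff₀ hβ, mul_comm]
        exact hXβ O hO
      refine h1.trans (mul_le_mul_of_nonneg_left ?_ (pow_nonneg (FairDiv.nashWelfare_nonneg hv _) n))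
      exact FairDiv.inv_pow_le_of_three_div_le hn hβ hq3
  obtain ⟨t, s, hexec, ht, hcase⟩ := FairDiv.runs_fairProg (s := FairDiv.startState X) hinp
    (by rw [h00]; exact hα1) (n := n) (m := m) rfl rfl hq1
    (fun g _ => by rw [hx0]; exact FairDiv.encodeAlloc_le hX g) hW₁ hR
  refine ⟨t, s, hexec, ?_, FairDiv.isAllocation_decodeAlloc _, ?_⟩
  · have h1 : (t : ℝ) ≤ 700 * (n + m + 1) ^ 6 * (⌈3 / β⌉₊ : ℝ) := by exact_mod_cast ht
    have h2 : (700 : ℝ) * (n + m + 1) ^ 6 * (⌈3 / β⌉₊ : ℝ) ≤ 700 * (n + m + 1) ^ 6 * (4 / β) :=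
      mul_le_mul_of_nonneg_left hq4 (by positivity)
    refine (h1.trans h2).trans_eq ?_
    simp only [Polynomial.eval_mul, Polynomial.eval_pow, Polynomial.eval_add, Polynomial.eval_X,
      Polynomial.eval_one, Polynomial.eval_ofNat]
    push_cast
    ring
  have hmem : ∀ (j : Fin n) (g : Fin m), g ∈ s.output n m j ↔ s.narr 0 g = j + 1 := by
    intro j g
    simp [FairDiv.State.output, FairDiv.decodeAlloc]
  rw [hx0] at hcase
  rcases hcase with ⟨μ, x, z, hold, mate, hs, hall, hy⟩ | ⟨⟨a, ha, hzero⟩, hy⟩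
  · rw [h00] at hs
    constructor
    · intro i j g hg
      have h1 := hs.phase.efx_output hall hy (FairDiv.succ_mem_Icc i) (FairDiv.succ_mem_Icc j)
        g.isLt ((hmem j g).1 hg)
      rw [FairDiv.bundleValue_inputTable hadd, FairDiv.bundleValue_inputTable hadd,
        FairDiv.inputTable_succ] at h1
      rw [(hadd i).sdiff_singleton hg]
      exact h1
    · intro Y hY
      have h1 := hs.welfare_output hinp hα hα1 hall hy
      rw [FairDiv.welfare_inputTable hadd, FairDiv.welfare_inputTable hadd, hdec] at h1
      rcases Nat.eq_zero_or_pos n with hn | hn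
      · subst hn
        -- Without agents, every Nash welfare is the empty product `1`, and the claim is `β / (α +
        -- 1) ≤ 1`.
        simp only [FairDiv.nashWelfare, Finset.univ_eq_empty, Finset.prod_empty, mul_one]
        rw [div_le_one (by linarith)]
        linarith
      · rw [← FairDiv.nashWelfare_pow hv hn.ne', ← FairDiv.nashWelfare_pow hv hn.ne',
          ← mul_pow] at h1
        have h2 := le_of_pow_le_pow_left₀ hn.ne'
          (mul_nonneg (by linarith) (FairDiv.nashWelfare_nonneg hv _)) h1
        rw [div_mul_eq_mul_div, div_le_iff₀ (by linarith), mul_comm (FairDiv.nashWelfare v _),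
          add_comm α]
        exact (hXβ Y hY).trans h2
  · constructor
    · intro i j g hg
      have h1 := (hmem j g).1 hg
      rw [hy g g.isLt] at h1
      exact absurd h1 (Nat.succ_ne_zero _).symm
    -- Some agent has value `0` in `X`, so `X` has Nash welfare `0`. Being β-MNW, it forces the
    -- maximum to be `0`, and any allocation is good enough.
    · intro Y hY
      obtain ⟨i, rfl⟩ := FairDiv.exists_of_mem_Icc ha
      rw [FairDiv.bundleValue_inputTable hadd, hdec] at hzero
      have h1 : v i (X i) = 0 := le_antisymm (not_lt.1 hzero) (hv i _)
      have h2 := hXβ Y hY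
      rw [FairDiv.nashWelfare_eq_zero h1] at h2
      have h3 : FairDiv.nashWelfare v Y ≤ 0 := nonpos_of_mul_nonpos_right h2 hβ
      exact (mul_nonpos_of_nonneg_of_nonpos (by positivity) h3).trans
        (FairDiv.nashWelfare_nonneg hv _)
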